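/- For an integer $l\ge 3$ let $\epsilon_l$ be a root of the irreducible polynomial $X^3+(l-1)X^2-lX-1\in\mathbb{Z}[X]$, and let $\mathbb{U}_l$ be the unit group of the ring of integers of the cubic field $\mathbb{Q}(\epsilon_l)$. Both $\epsilon_l$ and $\epsilon_l-1$ belong to $\mathbb{U}_l$; let $$j_l=(\mathbb{U}_l:\langle -1,\epsilon_l,\epsilon_l-1\rangle)$$ be the index in $\mathbb{U}_l$ of the subgroup generated by $-1$, $\epsilon_l$ and $\epsilon_l-1$. (i) For every prime $p\ge 3$ there are only finitely many integers $l\ge 3$ for which $p$ divides $j_l$. (ii) For every integer $N\ge 2$ there is an effective bound $l_N$ such that $\gcd(j_l,N!)=1$ for all integers $l\ge 3$ with $l\ge l_N$. Here effective means that $l_N$ can be computed from $N$: the function $N\mapsto l_N$ can be chosen to be computable. -/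

import Mathlib

open Polynomial NumberField

/-- The cubic polynomial `X³ + (l - 1) X² - l X - 1` with integer coefficients. -/
noncomputable def ennolaPoly (l : ℕ) : ℤ[X] :=
  X ^ 3 + C ((l : ℤ) - 1) * X ^ 2 - C (l : ℤ) * X - 1

theorem ennolaPoly_eq (l : ℕ) :
    ennolaPoly l =
      C 1 * X ^ 3 + C ((l : ℤ) - 1) * X ^ 2 + C (-(l : ℤ)) * X + C (-1) := by
  simp only [ennolaPoly, map_neg, map_one]
  ring

theorem ennolaPoly_natDegree (l : ℕ) : (ennolaPoly l).natDegree = 3 := by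
  rw [ennolaPoly_eq]
  exact natDegree_cubic one_ne_zero

theorem ennolaPoly_monic (l : ℕ) : (ennolaPoly l).Monic := by
  rw [Monic, ennolaPoly_eq]
  exact leadingCoeff_cubic one_ne_zero

theorem ennolaPoly_irreducible (l : ℕ) : Irreducible (ennolaPoly l) := by
  have hm := ennolaPoly_monic l
  rw [hm.irreducible_iff_roots_eq_zero_of_degree_le_three
    (by rw [ennolaPoly_natDegree]; norm_num) (by rw [ennolaPoly_natDegree])]
  refine Multiset.eq_zero_of_forall_notMem fun x hx => ?_
  rw [mem_roots hm.ne_zero, IsRoot.def] at hx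
  have h : x * ((x - 1) * (x + l)) = 1 := by
    simp only [ennolaPoly, eval_sub, eval_add, eval_mul, eval_pow, eval_X, eval_C, eval_one] at hx
    linear_combination hx
  rcases Int.isUnit_iff.1 (IsUnit.of_mul_eq_one _ h) with rfl | rfl
  · norm_num at h
  · omega

instance ennolaPoly_map_irreducible (l : ℕ) :
    Fact (Irreducible ((ennolaPoly l).map (Int.castRingHom ℚ))) :=
  ⟨((ennolaPoly_monic l).irreducible_iff_irreducible_map_fraction_map (K := ℚ)).1
    (ennolaPoly_irreducible l)⟩

/-- The cubic field `ℚ(ε_l) = ℚ[X] / (X³ + (l - 1) X² - l X - 1)`. -/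
abbrev EnnolaField (l : ℕ) : Type :=
  AdjoinRoot ((ennolaPoly l).map (Int.castRingHom ℚ))

/-- The root `ε_l` in the field `ℚ(ε_l)`. -/
noncomputable def ennolaRoot (l : ℕ) : EnnolaField l :=
  AdjoinRoot.root ((ennolaPoly l).map (Int.castRingHom ℚ))

theorem ennolaRoot_aeval (l : ℕ) : aeval (ennolaRoot l) (ennolaPoly l) = 0 := by
  rw [← aeval_map_algebraMap ℚ]
  exact AdjoinRoot.eval₂_root ((ennolaPoly l).map (Int.castRingHom ℚ))

/-- The root `ε_l` as an element of the ring of integers of `ℚ(ε_l)`. -/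
noncomputable def ennolaInt (l : ℕ) : 𝓞 (EnnolaField l) :=
  ⟨ennolaRoot l, ennolaPoly l, ennolaPoly_monic l, ennolaRoot_aeval l⟩

theorem ennolaInt_mul (l : ℕ) :
    ennolaInt l * ((ennolaInt l - 1) * (ennolaInt l + (l : 𝓞 (EnnolaField l)))) = 1 := by
  apply RingOfIntegers.coe_injective
  have h := ennolaRoot_aeval l
  simp only [ennolaPoly, map_sub, map_add, map_mul, map_pow, aeval_X, map_one,
    map_natCast] at h
  have e : algebraMap (𝓞 (EnnolaField l)) (EnnolaField l) (ennolaInt l) = ennolaRoot l := rfl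
  simp only [map_sub, map_add, map_mul, map_one, map_natCast, e]
  linear_combination h

/-- The unit `ε_l` of the ring of integers of `ℚ(ε_l)`. -/
noncomputable def ennolaUnit (l : ℕ) : (𝓞 (EnnolaField l))ˣ :=
  Units.mkOfMulEqOne (ennolaInt l) ((ennolaInt l - 1) * (ennolaInt l + l)) (ennolaInt_mul l)

/-- The unit `ε_l - 1` of the ring of integers of `ℚ(ε_l)`. -/
noncomputable def ennolaUnitSubOne (l : ℕ) : (𝓞 (EnnolaField l))ˣ :=
  Units.mkOfMulEqOne (ennolaInt l - 1) (ennolaInt l * (ennolaInt l + l))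
    (by linear_combination ennolaInt_mul l)

/-- The unit index `j_l = (U_l : ⟨-1, ε_l, ε_l - 1⟩)`, where `U_l` is the unit group of the ring
of integers of `ℚ(ε_l)`. -/
noncomputable def unitIndex (l : ℕ) : ℕ :=
  (Subgroup.closure {-1, ennolaUnit l, ennolaUnitSubOne l} :
    Subgroup (𝓞 (EnnolaField l))ˣ).index

/-! The roots lie near `0`, `1` and `-l`, so the conjugates of `ε^a (ε-1)^b` have absolute values of
order `l^(-a)`, `l^(-b)`, `l^(a+b)`. If a prime `p` divides the index, Cauchy's theorem gives a unit
`u` with `u^p = ±ε^a (ε-1)^b` and `a`, `b` not both divisible by `p` (`exists_hasExponents`). With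
`τ = l^(1/p)` and `n = (-a, -b, a+b)`, its conjugates have absolute values `τ^(n i) (1 + c i/(p l) +
O(l^(-2)))`, where the integers `c i` are linear in `n` (`HasExponents.hasSize`). Multiplying powers
of `u` by elements of the subgroup realises every zero-sum vector congruent mod `p` to a multiple of
`n` (`exists_of_eq_mul`).

Traces of these units are integers. The contradiction is always an integer written as a sum of terms
of distinct negative orders in `τ` plus a smaller error: it is nonzero and less than `1` in absolute
value once `τ ≥ 1000 p` (`intCast_ne_sum_add`). The residues of `n` mod `p` decide which units to
use. If one residue is zero, exponents `(p, -1, 1-p)` serve; if two are equal, multiples of `(1, 1,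
-2)`; the primes `2` and `3` need sign arguments.

If the residues are nonzero and distinct, a pigeonhole argument on residue sums
(`exists_residueSum_eq`) yields two units with the same positive exponent, at different places, and
negative exponents elsewhere. The large conjugates cancel in the difference of the traces, up to
sign, and only negative orders remain. These orders are distinct unless `r² + r s + s² = 0` for two
of the residues; then multiplication by a scalar permutes the residues cyclically, and the
second-order coefficients `c i` show that something survives. All this needs only `l ≥ (1000 p)^p`,
an explicit bound increasing in `p`, which gives both claims. -/

/-! ### Real embeddings and integrality of traces -/

/-- The `ℚ`-algebra homomorphism from the cubic field to a field of characteristic zero which sends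
`ε_l` to a given root of the defining polynomial. -/
noncomputable def ennolaLift {F : Type*} [Field F] [Algebra ℚ F] {l : ℕ} {x : F}
    (hx : x * ((x - 1) * (x + l)) = 1) : EnnolaField l →ₐ[ℚ] F :=
  AdjoinRoot.liftAlgHom _ (Algebra.ofId ℚ F) x (by
    rw [eval₂_map]
    simp only [ennolaPoly, eval₂_sub, eval₂_add, eval₂_mul, eval₂_pow, eval₂_X,
      eval₂_natCast, eval₂_one, map_sub, map_natCast, map_one]
    linear_combination hx)

theorem ennolaLift_root {F : Type*} [Field F] [Algebra ℚ F] {l : ℕ} {x : F}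
    (hx : x * ((x - 1) * (x + l)) = 1) : ennolaLift hx (ennolaRoot l) = x := by
  exact AdjoinRoot.liftAlgHom_root _ _ _ _

theorem finrank_ennolaField (l : ℕ) : Module.finrank ℚ (EnnolaField l) = 3 := by
  have hm : ((ennolaPoly l).map (Int.castRingHom ℚ)).Monic := (ennolaPoly_monic l).map _
  rw [(AdjoinRoot.powerBasis hm.ne_zero).finrank, AdjoinRoot.powerBasis_dim,
    (ennolaPoly_monic l).natDegree_map, ennolaPoly_natDegree]

/-- A numbering of the three real roots of the defining polynomial of `ℚ(ε_l)`. -/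
structure IsEnnolaRoots (l : ℕ) (θ : Fin 3 → ℝ) : Prop where
  root : ∀ i, θ i * ((θ i - 1) * (θ i + l)) = 1
  inj : Function.Injective θ

namespace IsEnnolaRoots

variable {l : ℕ} {θ : Fin 3 → ℝ}

/-- The real embedding attached to a root. -/
noncomputable def emb (h : IsEnnolaRoots l θ) (i : Fin 3) : EnnolaField l →ₐ[ℚ] ℝ :=
  ennolaLift (h.root i)

/-- The complex embedding attached to a root. -/
noncomputable def cemb (h : IsEnnolaRoots l θ) (i : Fin 3) : EnnolaField l →ₐ[ℚ] ℂ :=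
  (Complex.ofRealAm.restrictScalars ℚ).comp (h.emb i)

theorem emb_root (h : IsEnnolaRoots l θ) (i : Fin 3) : h.emb i (ennolaRoot l) = θ i :=
  ennolaLift_root _

theorem cemb_apply (h : IsEnnolaRoots l θ) (i : Fin 3) (x : EnnolaField l) :
    h.cemb i x = (h.emb i x : ℂ) := rfl

theorem cemb_bijective (h : IsEnnolaRoots l θ) : Function.Bijective h.cemb := by
  rw [Fintype.bijective_iff_injective_and_card]
  refine ⟨fun i j hij => h.inj ?_, ?_⟩
  · have := congrArg (fun σ => σ (ennolaRoot l)) hij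
    simpa [cemb_apply, emb_root] using this
  · rw [AlgHom.card, finrank_ennolaField, Fintype.card_fin]

theorem trace_eq_sum (h : IsEnnolaRoots l θ) (x : EnnolaField l) :
    ((Algebra.trace ℚ (EnnolaField l) x : ℚ) : ℝ) = ∑ i, h.emb i x := by
  have := trace_eq_sum_embeddings (K := ℚ) (L := EnnolaField l) ℂ (x := x)
  rw [← h.cemb_bijective.sum_comp (fun σ => σ x)] at this
  simp only [cemb_apply] at this
  apply Complex.ofReal_injective
  push_cast
  simpa using this

/-- The sum is the trace of an algebraic integer. This is the only source of integrality in the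
argument. -/
theorem exists_int_eq_sum (h : IsEnnolaRoots l θ) (x : 𝓞 (EnnolaField l)) :
    ∃ t : ℤ, (t : ℝ) = ∑ i, h.emb i x := by
  refine ⟨Algebra.intTrace ℤ (𝓞 (EnnolaField l)) x, ?_⟩
  rw [← h.trace_eq_sum]
  have := Algebra.algebraMap_intTrace (A := ℤ) (K := ℚ) (L := EnnolaField l) x
  rw [← this]
  simp

theorem isTotallyReal (h : IsEnnolaRoots l θ) : IsTotallyReal (EnnolaField l) := by
  refine ⟨fun v => ?_⟩
  obtain ⟨i, hi⟩ := h.cemb_bijective.2 (RingHom.toRatAlgHom v.embedding)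
  have : v.embedding = (h.cemb i : EnnolaField l →+* ℂ) := by
    rw [hi]; rfl
  rw [InfinitePlace.isReal_iff, this]
  rw [ComplexEmbedding.isReal_iff]
  refine RingHom.ext fun x => ?_
  change (starRingEnd ℂ) ((h.emb i x : ℝ) : ℂ) = _
  rw [Complex.conj_ofReal]
  rfl

theorem rank_eq_two (h : IsEnnolaRoots l θ) : Units.rank (EnnolaField l) = 2 := by
  have := h.isTotallyReal
  have h3 := IsTotallyReal.finrank (EnnolaField l)
  have h2 := IsTotallyReal.nrComplexPlaces_eq_zero (EnnolaField l)
  have h1 := InfinitePlace.card_eq_nrRealPlaces_add_nrComplexPlaces (EnnolaField l)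
  rw [finrank_ennolaField] at h3
  rw [Units.rank, h1, ← h3, h2]

end IsEnnolaRoots

/-! ### Location of the roots and asymptotics of their logarithms -/

/-- The real roots of the defining polynomial, numbered by their location: close to `0`, `1`
and `-l`. -/
structure IsLocatedRoots (l : ℕ) (θ : Fin 3 → ℝ) : Prop where
  root : ∀ i, θ i * ((θ i - 1) * (θ i + l)) = 1
  lower_zero : -(1 / (l : ℝ)) < θ 0
  upper_zero : θ 0 < -(1 / ((l : ℝ) + 1))
  lower_one : 1 + 1 / ((l : ℝ) + 3) < θ 1
  upper_one : θ 1 < 1 + 1 / (l : ℝ)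
  lower_two : -(l : ℝ) < θ 2
  upper_two : θ 2 < -(l : ℝ) + 1 / (l : ℝ) ^ 2

theorem exists_isLocatedRoots {l : ℕ} (hl : 3 ≤ l) : ∃ θ, IsLocatedRoots l θ := by
  have hl' : (3 : ℝ) ≤ l := by exact_mod_cast hl
  have h0 : (0 : ℝ) < l := by linarith
  set f : ℝ → ℝ := fun x => x * ((x - 1) * (x + l)) with hf
  have hc : Continuous f := by fun_prop
  have key : ∀ a b : ℝ, a ≤ b → (f a < 1 ∧ 1 < f b ∨ 1 < f a ∧ f b < 1) →
      ∃ x, a < x ∧ x < b ∧ f x = 1 := by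
    rintro a b hab (⟨h1, h2⟩ | ⟨h1, h2⟩)
    · obtain ⟨x, hx, hx1⟩ := intermediate_value_Ioo hab hc.continuousOn ⟨h1, h2⟩
      exact ⟨x, hx.1, hx.2, hx1⟩
    · obtain ⟨x, hx, hx1⟩ := intermediate_value_Ioo' hab hc.continuousOn ⟨h2, h1⟩
      exact ⟨x, hx.1, hx.2, hx1⟩
  obtain ⟨x, hx1, hx2, hx⟩ := key (-(1 / (l : ℝ))) (-(1 / ((l : ℝ) + 1)))
    (neg_le_neg (one_div_le_one_div_of_le h0 (by linarith))) (by
      right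
      constructor
      · have : f (-(1 / (l : ℝ))) = 1 + (l ^ 2 - l - 1) / l ^ 3 := by
          simp only [hf]; field_simp; ring
        rw [this]
        have : 0 < ((l : ℝ) ^ 2 - l - 1) / l ^ 3 := div_pos (by nlinarith) (by positivity)
        linarith
      · have : f (-(1 / ((l : ℝ) + 1))) = 1 - (2 * l + 3) / (l + 1) ^ 3 := by
          simp only [hf]; field_simp; ring
        rw [this]
        have : 0 < (2 * (l : ℝ) + 3) / (l + 1) ^ 3 := by positivity
        linarith)
  -- The shift `3` is needed: at `1 + 1/(l+2)` the function already exceeds `1`.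
  obtain ⟨y, hy1, hy2, hy⟩ := key (1 + 1 / ((l : ℝ) + 3)) (1 + 1 / (l : ℝ))
    (by gcongr; linarith) (by
      left
      constructor
      · have : f (1 + 1 / ((l : ℝ) + 3)) = 1 - (l ^ 2 + 7 * l + 11) / (l + 3) ^ 3 := by
          simp only [hf]; field_simp; ring
        rw [this]
        have : 0 < ((l : ℝ) ^ 2 + 7 * l + 11) / (l + 3) ^ 3 := by positivity
        linarith
      · have : f (1 + 1 / (l : ℝ)) = 1 + (2 * l ^ 2 + 2 * l + 1) / l ^ 3 := by
          simp only [hf]; field_simp; ring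
        rw [this]
        have : 0 < (2 * (l : ℝ) ^ 2 + 2 * l + 1) / l ^ 3 := by positivity
        linarith)
  obtain ⟨z, hz1, hz2, hz⟩ := key (-(l : ℝ)) (-(l : ℝ) + 1 / (l : ℝ) ^ 2)
    (by have : 0 < 1 / (l : ℝ) ^ 2 := by positivity
        linarith) (by
      left
      constructor
      · simp [hf]
      · have : f (-(l : ℝ) + 1 / (l : ℝ) ^ 2) = 1 + (l ^ 5 - 2 * l ^ 3 - l ^ 2 + 1) / l ^ 6 := by
          simp only [hf]; field_simp; ring
        rw [this]
        have : 0 < ((l : ℝ) ^ 5 - 2 * l ^ 3 - l ^ 2 + 1) / l ^ 6 := by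
          refine div_pos ?_ (by positivity)
          have h2 : (9 : ℝ) ≤ l ^ 2 := by nlinarith
          have h3 : (l : ℝ) ^ 2 ≤ l ^ 3 := pow_le_pow_right₀ (by linarith) (by norm_num)
          nlinarith [pow_pos h0 3]
        linarith)
  refine ⟨![x, y, z], ?_, hx1, hx2, hy1, hy2, hz1, hz2⟩
  intro i
  fin_cases i
  · exact hx
  · exact hy
  · exact hz

theorem log_one_add_bounds {t : ℝ} (ht : -(1 / 2) ≤ t) :
    t - 2 * t ^ 2 ≤ Real.log (1 + t) ∧ Real.log (1 + t) ≤ t := by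
  have hpos : 0 < 1 + t := by linarith
  constructor
  · refine le_trans ?_ (Real.one_sub_inv_le_log_of_pos hpos)
    have : 1 - (1 + t)⁻¹ = t - t ^ 2 / (1 + t) := by field_simp; ring
    rw [this]
    have : t ^ 2 / (1 + t) ≤ 2 * t ^ 2 := by
      rw [div_le_iff₀ hpos]; nlinarith [sq_nonneg t]
    linarith
  · have := Real.log_le_sub_one_of_pos hpos
    linarith

/-- The growth exponents of the conjugates of `ε_l` with respect to `l`. -/
def expRoot : Fin 3 → ℤ := ![-1, 0, 1]

/-- The coefficients of `1 / l` in the logarithms of the conjugates of `ε_l`. -/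
def coeffRoot : Fin 3 → ℤ := ![-1, 1, 0]

/-- The growth exponents of the conjugates of `ε_l - 1` with respect to `l`. -/
def expSubOne : Fin 3 → ℤ := ![0, -1, 1]

/-- The coefficients of `1 / l` in the logarithms of the conjugates of `ε_l - 1`. -/
def coeffSubOne : Fin 3 → ℤ := ![1, -2, 1]

namespace IsLocatedRoots

variable {l : ℕ} {θ : Fin 3 → ℝ}

theorem isEnnolaRoots (h : IsLocatedRoots l θ) (hl : 3 ≤ l) : IsEnnolaRoots l θ := by
  have hl' : (3 : ℝ) ≤ l := by exact_mod_cast hl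
  have a := h.upper_zero
  have b := h.lower_one
  have c := h.upper_two
  have d := h.lower_zero
  have e1 : 0 < 1 / ((l : ℝ) + 1) := by positivity
  have e2 : 0 < 1 / ((l : ℝ) + 3) := by positivity
  have e3 : 1 / (l : ℝ) ^ 2 ≤ 1 := by
    rw [div_le_one (by positivity)]; nlinarith
  have e4 : 1 / (l : ℝ) ≤ 1 := by
    rw [div_le_one (by positivity)]; linarith
  have h20 : θ 2 < θ 0 := by linarith
  have h01 : θ 0 < θ 1 := by linarith
  refine ⟨h.root, fun i j hij => ?_⟩
  fin_cases i <;> fin_cases j <;> simp only [Fin.zero_eta, Fin.mk_one, Fin.reduceFinMk] at hij ⊢ <;>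
    linarith

theorem log_add_log_add_log (h : IsLocatedRoots l θ) (i : Fin 3) :
    Real.log |θ i| + Real.log |θ i - 1| + Real.log |θ i + l| = 0 := by
  have hr := h.root i
  have h1 : θ i ≠ 0 := by rintro h0; simp [h0] at hr
  have h2 : θ i - 1 ≠ 0 := by rintro h0; simp [h0] at hr
  have h3 : θ i + l ≠ 0 := by rintro h0; simp [h0] at hr
  rw [Real.log_abs, Real.log_abs, Real.log_abs, ← Real.log_mul h1 h2, ← Real.log_mul
    (mul_ne_zero h1 h2) h3, mul_assoc, hr, Real.log_one]

-- At each root at least two of `|θ|`, `|θ - 1|`, `|θ + l|` have the form `1 + t` or `l (1 + t)`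
-- with `t` small and known up to `O(l^(-2))`. The logarithm of a remaining tiny factor comes from
-- the vanishing sum of the three logarithms, so the root need not be located to higher relative
-- precision.
set_option maxHeartbeats 800000 in
theorem abs_log_bounds (h : IsLocatedRoots l θ) (hl : 3 ≤ l) (i : Fin 3) :
    |Real.log |θ i| - (expRoot i * Real.log l + coeffRoot i / l)| ≤ 10 / (l : ℝ) ^ 2 ∧
    |Real.log |θ i - 1| - (expSubOne i * Real.log l + coeffSubOne i / l)| ≤
      10 / (l : ℝ) ^ 2 := by
  have hl' : (3 : ℝ) ≤ l := by exact_mod_cast hl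
  have h0 : (0 : ℝ) < l := by linarith
  have hsum := h.log_add_log_add_log i
  obtain ⟨q, hq⟩ : ∃ q : ℝ, q = 1 / (l : ℝ) := ⟨_, rfl⟩
  have hq0 : 0 < q := by rw [hq]; positivity
  have hq1 : q ≤ 1 / 3 := by rw [hq]; exact one_div_le_one_div_of_le (by norm_num) hl'
  have hlq : (l : ℝ) * q = 1 := by rw [hq]; field_simp
  have hdiv : ∀ x : ℝ, x / l = x * q := fun x => by rw [hq]; ring
  have hdiv2 : 10 / (l : ℝ) ^ 2 = 10 * q ^ 2 := by rw [hq]; field_simp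
  have hq3 : q ^ 3 ≤ q ^ 2 / 3 := by nlinarith [sq_nonneg q]
  have hq4 : q ^ 4 ≤ q ^ 2 / 9 := by nlinarith [sq_nonneg q]
  rw [hdiv, hdiv, hdiv2, abs_le, abs_le]
  have hlog : ∀ t : ℝ, -(1 / 2) ≤ t → Real.log (l * (1 + t)) = Real.log l + Real.log (1 + t) :=
    fun t ht => Real.log_mul h0.ne' (by linarith)
  fin_cases i
  · have ha := h.lower_zero
    have hb := h.upper_zero
    simp only [Fin.zero_eta] at hsum ⊢
    obtain ⟨d, hd⟩ : ∃ d, d = -θ 0 := ⟨_, rfl⟩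
    have hd1 : d < q := by rw [hq]; linarith
    have hd2 : q - q ^ 2 < d := by
      have : 1 / ((l : ℝ) + 1) ≥ q - q ^ 2 := by
        rw [ge_iff_le, le_div_iff₀ (by linarith)]; nlinarith
      linarith
    have hd0 : 0 < d := by nlinarith
    have e1 : |θ 0 - 1| = 1 + d := by rw [abs_of_neg (by linarith)]; linarith
    have e2 : |θ 0 + l| = l * (1 + -(d * q)) := by
      rw [abs_of_pos (by nlinarith)]; linear_combination hd + d * hlq
    have hdq : d * q ≤ q ^ 2 := by rw [sq]; gcongr
    have hdq0 : 0 < d * q := by positivity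
    have ht : -(1 / 2) ≤ -(d * q) := by nlinarith
    have b1 := log_one_add_bounds (t := d) (by linarith)
    have b2 := log_one_add_bounds ht
    rw [e1, e2, hlog _ ht] at hsum
    rw [e1]
    simp only [expRoot, coeffRoot, expSubOne, coeffSubOne, Matrix.cons_val_zero]
    push_cast
    have hd3 : d ^ 2 ≤ q ^ 2 := by gcongr
    have hd4 : (-(d * q)) ^ 2 ≤ q ^ 4 := by
      calc (-(d * q)) ^ 2 = (d * q) ^ 2 := by ring
        _ ≤ (q ^ 2) ^ 2 := by gcongr
        _ = q ^ 4 := by ring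
    refine ⟨⟨?_, ?_⟩, ?_, ?_⟩ <;> linarith
  · have ha := h.lower_one
    have hb := h.upper_one
    simp only [Fin.mk_one] at hsum ⊢
    obtain ⟨d, hd⟩ : ∃ d, d = θ 1 - 1 := ⟨_, rfl⟩
    have hd1 : d < q := by rw [hq]; linarith
    have hd2 : q - 3 * q ^ 2 < d := by
      have : 1 / ((l : ℝ) + 3) ≥ q - 3 * q ^ 2 := by
        rw [ge_iff_le, le_div_iff₀ (by linarith)]; nlinarith
      linarith
    have hd0 : 0 < d := by nlinarith
    have e1 : |θ 1| = 1 + d := by rw [abs_of_pos (by linarith)]; linarith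
    have e2 : |θ 1 + l| = l * (1 + (1 + d) * q) := by
      rw [abs_of_pos (by nlinarith)]; linear_combination -hd - (1 + d) * hlq
    have ht : -(1 / 2) ≤ (1 + d) * q := by
      have : 0 < (1 + d) * q := by positivity
      linarith
    have b1 := log_one_add_bounds (t := d) (by linarith)
    have b2 := log_one_add_bounds ht
    rw [e1, e2, hlog _ ht] at hsum
    rw [e1]
    simp only [expRoot, coeffRoot, expSubOne, coeffSubOne, Matrix.cons_val_one,
      Matrix.cons_val_zero]
    push_cast
    have hd3 : d ^ 2 ≤ q ^ 2 := by gcongr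
    have hd4 : (1 + d) * q ≤ q + q ^ 2 := by
      calc (1 + d) * q ≤ (1 + q) * q := by gcongr
        _ = q + q ^ 2 := by ring
    have hd5 : q ≤ (1 + d) * q := le_mul_of_one_le_left hq0.le (by linarith)
    have hd6 : ((1 + d) * q) ^ 2 ≤ 2 * q ^ 2 := by
      calc ((1 + d) * q) ^ 2 ≤ (q + q ^ 2) ^ 2 := by gcongr
        _ = q ^ 2 + 2 * q ^ 3 + q ^ 4 := by ring
        _ ≤ 2 * q ^ 2 := by linarith [sq_nonneg q]
    refine ⟨⟨?_, ?_⟩, ?_, ?_⟩ <;> linarith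
  · have ha := h.lower_two
    have hb := h.upper_two
    simp only [Fin.reduceFinMk] at hsum ⊢
    obtain ⟨d, hd⟩ : ∃ d, d = θ 2 + l := ⟨_, rfl⟩
    have hd1 : d < q ^ 2 := by
      have : q ^ 2 = 1 / (l : ℝ) ^ 2 := by rw [hq]; field_simp
      linarith
    have hd0 : 0 < d := by linarith
    have e1 : |θ 2| = l * (1 + -(d * q)) := by
      rw [abs_of_neg (by nlinarith)]; linear_combination hd + d * hlq
    have e2 : |θ 2 - 1| = l * (1 + (1 - d) * q) := by
      rw [abs_of_neg (by nlinarith)]; linear_combination hd - (1 - d) * hlq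
    have hdq : d * q ≤ q ^ 3 := by rw [pow_succ]; gcongr
    have hdq0 : 0 < d * q := by positivity
    have ht : -(1 / 2) ≤ -(d * q) := by nlinarith
    have ht' : -(1 / 2) ≤ (1 - d) * q := by nlinarith
    have b1 := log_one_add_bounds ht
    have b2 := log_one_add_bounds ht'
    rw [e1, e2, hlog _ ht, hlog _ ht']
    simp only [expRoot, coeffRoot, expSubOne, coeffSubOne, Matrix.cons_val]
    push_cast
    have hd4 : (-(d * q)) ^ 2 ≤ q ^ 2 := by
      calc (-(d * q)) ^ 2 = d ^ 2 * q ^ 2 := by ring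
        _ ≤ 1 ^ 2 * q ^ 2 := by gcongr; nlinarith
        _ = q ^ 2 := by ring
    have hd5 : (1 - d) * q ≤ q := by linarith
    have hd6 : q - q ^ 3 ≤ (1 - d) * q := by linarith
    have hd7 : ((1 - d) * q) ^ 2 ≤ q ^ 2 := by
      have : 0 ≤ (1 - d) * q := by nlinarith
      gcongr
    refine ⟨⟨?_, ?_⟩, ?_, ?_⟩ <;> linarith

end IsLocatedRoots

/-! ### Sizes of conjugates to second order on the scale of `τ` -/

/-- `τ` is the `p`-th root of `l`, and it is large with respect to `p`. -/
structure IsScale (l p : ℕ) (τ : ℝ) : Prop where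
  two_le : 2 ≤ p
  pow_eq : τ ^ p = l
  le : 1000 * (p : ℝ) ≤ τ

namespace IsScale

variable {l p : ℕ} {τ : ℝ}

theorem large (h : IsScale l p τ) : 2000 ≤ τ := by
  have := h.le
  have h2 : (2 : ℝ) ≤ p := by exact_mod_cast h.two_le
  linarith

theorem pos (h : IsScale l p τ) : 0 < τ := by linarith [h.large]

theorem le_cast (h : IsScale l p τ) : τ ≤ l := by
  rw [← h.pow_eq]
  exact le_self_pow₀ (by linarith [h.large]) (by have := h.two_le; omega)

theorem cast_pos (h : IsScale l p τ) : (0 : ℝ) < l := by linarith [h.le_cast, h.large]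

theorem three_le (h : IsScale l p τ) : 3 ≤ l := by
  have : (3 : ℝ) ≤ l := by linarith [h.le_cast, h.large]
  exact_mod_cast this

theorem p_pos (h : IsScale l p τ) : (0 : ℝ) < p := by
  have := h.two_le
  positivity

theorem zpow_sub (h : IsScale l p τ) (n : ℤ) : τ ^ (n - p) = τ ^ n / l := by
  rw [zpow_sub₀ h.pos.ne', zpow_natCast, h.pow_eq]

theorem zpow_sub_two (h : IsScale l p τ) (n : ℤ) : τ ^ (n - 2 * p) = τ ^ n / (l : ℝ) ^ 2 := by
  rw [show n - 2 * (p : ℤ) = n - p - p by ring, h.zpow_sub, h.zpow_sub, div_div, sq]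

theorem zpow_le_zpow (h : IsScale l p τ) {m n : ℤ} (hmn : m ≤ n) : τ ^ m ≤ τ ^ n :=
  zpow_le_zpow_right₀ (by linarith [h.large]) hmn

end IsScale

/-- The absolute value of `x` is `τ ^ n * (1 + c / (p * l))` up to a relative error of
order `1 / l ^ 2`. -/
def HasSize (l p : ℕ) (τ : ℝ) (n c : ℤ) (x : ℝ) : Prop :=
  |(c : ℝ)| ≤ 3 * p ∧ |(|x| - τ ^ n * (1 + c / (p * l)))| ≤ 40 * τ ^ n / (l : ℝ) ^ 2

/-- Dividing by `p` and exponentiating: with `|x| = τ^n e^d` one has `d = c/(p l) + O(l^(-2))`, and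
`e^d - 1 - d` is `O(l^(-2))` too, since `c/p` is bounded. -/
theorem hasSize_of_log {l p : ℕ} {τ : ℝ} (h : IsScale l p τ) {n c : ℤ} {x : ℝ} (hx : x ≠ 0)
    (hc : |(c : ℝ)| ≤ 3 * p)
    (hlog : |p * Real.log |x| - (n * Real.log l + c / l)| ≤ 20 * p / (l : ℝ) ^ 2) :
    HasSize l p τ n c x := by
  refine ⟨hc, ?_⟩
  have hp := h.p_pos
  have hl := h.cast_pos
  have hll : (2000 : ℝ) ≤ l := h.large.trans h.le_cast
  have hlogl : Real.log l = p * Real.log τ := by rw [← h.pow_eq, Real.log_pow]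
  obtain ⟨d, hd⟩ : ∃ d, d = Real.log |x| - n * Real.log τ := ⟨_, rfl⟩
  have hxd : |x| = τ ^ n * Real.exp d := by
    rw [hd, Real.exp_sub, Real.exp_log (abs_pos.2 hx), ← Real.log_zpow,
      Real.exp_log (zpow_pos h.pos n)]
    field_simp [(zpow_pos h.pos n).ne']
  have h1 : |d - c / (p * l)| ≤ 20 / (l : ℝ) ^ 2 := by
    have : p * (d - c / (p * l)) = p * Real.log |x| - (n * Real.log l + c / l) := by
      rw [hd, hlogl]; field_simp; ring
    rw [← this, abs_mul, abs_of_pos hp, mul_comm (20 : ℝ), mul_div_assoc] at hlog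
    exact le_of_mul_le_mul_left hlog hp
  have h2 : |(c : ℝ) / (p * l)| ≤ 3 / l := by
    rw [abs_div, abs_of_pos (mul_pos hp hl), div_le_div_iff₀ (mul_pos hp hl) hl]
    calc |(c : ℝ)| * l ≤ 3 * p * l := by gcongr
      _ = 3 * (p * l) := by ring
  have h3 : |d| ≤ 4 / l := by
    have : 20 / (l : ℝ) ^ 2 ≤ 1 / l := by
      rw [div_le_div_iff₀ (by positivity) hl]; nlinarith
    calc |d| = |(d - c / (p * l)) + c / (p * l)| := by ring_nf
      _ ≤ 1 / l + 3 / l := (abs_add_le _ _).trans (by linarith)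
      _ = 4 / l := by ring
  have h4 : |d| ≤ 1 := h3.trans (by rw [div_le_one hl]; linarith)
  have h5 := Real.abs_exp_sub_one_sub_id_le h4
  have h6 : d ^ 2 ≤ 16 / (l : ℝ) ^ 2 := by
    rw [← sq_abs]
    calc |d| ^ 2 ≤ (4 / l) ^ 2 := by gcongr
      _ = 16 / (l : ℝ) ^ 2 := by ring
  have h7 : |Real.exp d - (1 + c / (p * l))| ≤ 40 / (l : ℝ) ^ 2 := by
    calc |Real.exp d - (1 + c / (p * l))|
        = |(Real.exp d - 1 - d) + (d - c / (p * l))| := by ring_nf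
      _ ≤ 16 / (l : ℝ) ^ 2 + 20 / (l : ℝ) ^ 2 :=
        (abs_add_le _ _).trans (add_le_add (h5.trans h6) h1)
      _ = 36 / (l : ℝ) ^ 2 := by ring
      _ ≤ 40 / (l : ℝ) ^ 2 := by gcongr; norm_num
  rw [hxd, ← mul_sub, abs_mul, abs_of_pos (zpow_pos h.pos n)]
  calc τ ^ n * |Real.exp d - (1 + c / (p * l))| ≤ τ ^ n * (40 / (l : ℝ) ^ 2) := by
        have := zpow_pos h.pos n
        gcongr
    _ = 40 * τ ^ n / (l : ℝ) ^ 2 := by ring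

namespace HasSize

variable {l p : ℕ} {τ : ℝ} {n c c' : ℤ} {x y : ℝ}

theorem abs_sub_le (h : IsScale l p τ) (hx : HasSize l p τ n c x) :
    |(|x| - τ ^ n)| ≤ 4 * τ ^ n / l := by
  obtain ⟨h1, h2⟩ := hx
  have hp := h.p_pos
  have hl := h.cast_pos
  have hll : (2000 : ℝ) ≤ l := h.large.trans h.le_cast
  have ht := zpow_pos h.pos n
  have h3 : |τ ^ n * (c / (p * l))| ≤ 3 * τ ^ n / l := by
    rw [abs_mul, abs_of_pos ht, abs_div, abs_of_pos (mul_pos hp hl)]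
    calc τ ^ n * (|(c : ℝ)| / (p * l)) ≤ τ ^ n * (3 * p / (p * l)) := by gcongr
      _ = 3 * τ ^ n / l := by field_simp
  have h4 : 40 * τ ^ n / (l : ℝ) ^ 2 ≤ τ ^ n / l := by
    rw [div_le_div_iff₀ (by positivity) hl]
    nlinarith [mul_pos ht hl]
  calc |(|x| - τ ^ n)|
      = |(|x| - τ ^ n * (1 + c / (p * l))) + τ ^ n * (c / (p * l))| := by ring_nf
    _ ≤ τ ^ n / l + 3 * τ ^ n / l := (abs_add_le _ _).trans (by linarith)
    _ = 4 * τ ^ n / l := by ring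

theorem bounds (h : IsScale l p τ) (hx : HasSize l p τ n c x) :
    τ ^ n / 2 ≤ |x| ∧ |x| ≤ 2 * τ ^ n := by
  have h1 := hx.abs_sub_le h
  have ht := zpow_pos h.pos n
  have hll : (2000 : ℝ) ≤ l := h.large.trans h.le_cast
  have h2 : 4 * τ ^ n / l ≤ τ ^ n / 2 := by
    rw [div_le_div_iff₀ h.cast_pos (by norm_num)]; nlinarith
  rw [abs_le] at h1
  constructor <;> linarith

theorem ne_zero (h : IsScale l p τ) (hx : HasSize l p τ n c x) : x ≠ 0 := by
  have := (hx.bounds h).1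
  have ht := zpow_pos h.pos n
  exact abs_pos.1 (by linarith)

/-- The difference of the absolute values of two numbers with the same growth exponent. -/
theorem abs_sub_abs (h : IsScale l p τ) (hx : HasSize l p τ n c x) (hy : HasSize l p τ n c' y) :
    |(|x| - |y| - ((c - c' : ℤ) : ℝ) / p * τ ^ (n - p))| ≤ 80 * τ ^ (n - 2 * p) := by
  rw [h.zpow_sub, h.zpow_sub_two]
  have hp := h.p_pos
  have hl := h.cast_pos
  have e : |x| - |y| - ((c - c' : ℤ) : ℝ) / p * (τ ^ n / l) =
      (|x| - τ ^ n * (1 + c / (p * l))) - (|y| - τ ^ n * (1 + c' / (p * l))) := by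
    push_cast; field_simp; ring
  rw [e]
  calc _ ≤ _ := abs_sub _ _
    _ ≤ 40 * τ ^ n / (l : ℝ) ^ 2 + 40 * τ ^ n / (l : ℝ) ^ 2 := add_le_add hx.2 hy.2
    _ = _ := by ring

theorem abs_sub_abs_le (h : IsScale l p τ) (hx : HasSize l p τ n c x)
    (hy : HasSize l p τ n c' y) : |(|x| - |y|)| ≤ 8 * τ ^ (n - p) := by
  have h1 := hx.abs_sub_le h
  have h2 := hy.abs_sub_le h
  rw [h.zpow_sub]
  calc |(|x| - |y|)| = |(|x| - τ ^ n) - (|y| - τ ^ n)| := by ring_nf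
    _ ≤ 4 * τ ^ n / l + 4 * τ ^ n / l := (abs_sub _ _).trans (add_le_add h1 h2)
    _ = 8 * (τ ^ n / l) := by ring

end HasSize

/-! ### The dominant term principle -/

/-- A sum of terms of pairwise different growth exponents, all of them negative, is not an
integer. -/
theorem intCast_ne_sum_add {ι : Type*} {τ a b : ℝ} {I : Finset ι} {t : ι → ℝ} {e : ι → ℤ}
    {R : ℝ} {E : ℤ} (hτ : 1 ≤ τ) (hb : 0 ≤ b) (hI : I.card ≤ 5) (he : Set.InjOn e I)
    (hlow : ∀ m ∈ I, a * τ ^ e m ≤ |t m|) (hup : ∀ m ∈ I, |t m| ≤ b * τ ^ e m)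
    (hneg : ∀ m ∈ I, e m < 0) (hR : |R| ≤ b * τ ^ E) (hE : ∃ m ∈ I, E < e m)
    (h1 : 6 * b < τ) (h2 : 6 * b < a * τ) (F : ℤ) : (F : ℝ) ≠ ∑ m ∈ I, t m + R := by
  classical
  intro hF
  have hτ0 : 0 < τ := by linarith
  obtain ⟨m₁, hm₁, hEm⟩ := hE
  obtain ⟨m₀, hm₀, hmax⟩ := I.exists_max_image e ⟨m₁, hm₁⟩
  have hpos := zpow_pos hτ0 (e m₀ - 1)
  -- At most four other terms and the error `R`, each smaller than the top order by a factor `τ` at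
  -- least. Hence the `5`, and the `6 b` in the hypotheses.
  have hrest : |∑ m ∈ I.erase m₀, t m + R| ≤ 5 * (b * τ ^ (e m₀ - 1)) := by
    have hs : |∑ m ∈ I.erase m₀, t m| ≤ 4 * (b * τ ^ (e m₀ - 1)) := by
      refine (Finset.abs_sum_le_sum_abs _ _).trans ?_
      refine (Finset.sum_le_card_nsmul _ _ (b * τ ^ (e m₀ - 1)) fun m hm => ?_).trans ?_
      · obtain ⟨hne, hmI⟩ := Finset.mem_erase.1 hm
        refine (hup m hmI).trans (mul_le_mul_of_nonneg_left (zpow_le_zpow_right₀ hτ ?_) hb)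
        have := hmax m hmI
        have h3 : e m ≠ e m₀ := fun h => hne (he hmI hm₀ h)
        omega
      · rw [nsmul_eq_mul]
        have : (((I.erase m₀).card : ℕ) : ℝ) ≤ 4 := by
          rw [Finset.card_erase_of_mem hm₀]
          exact_mod_cast (by omega : I.card - 1 ≤ 4)
        gcongr
    have hR' : |R| ≤ b * τ ^ (e m₀ - 1) := by
      refine hR.trans (mul_le_mul_of_nonneg_left (zpow_le_zpow_right₀ hτ ?_) hb)
      have := hmax m₁ hm₁
      omega
    exact (abs_add_le _ _).trans (by linarith)
  have hsum : ∑ m ∈ I, t m + R = t m₀ + (∑ m ∈ I.erase m₀, t m + R) := by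
    rw [← Finset.add_sum_erase I t hm₀, add_assoc]
  have hz : τ ^ e m₀ = τ * τ ^ (e m₀ - 1) := by
    rw [mul_comm, ← zpow_add_one₀ hτ0.ne']; ring_nf
  rw [hsum] at hF
  have hne : F ≠ 0 := by
    rintro rfl
    have h3 := hlow m₀ hm₀
    have h4 : |t m₀| ≤ 5 * (b * τ ^ (e m₀ - 1)) := by
      have : t m₀ = -(∑ m ∈ I.erase m₀, t m + R) := by push_cast at hF; linarith
      rw [this, abs_neg]; exact hrest
    rw [hz] at h3
    nlinarith [mul_nonneg hb hpos.le]
  have hlt : |(F : ℝ)| < 1 := by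
    rw [hF]
    have h3 := hup m₀ hm₀
    have h4 : τ ^ e m₀ ≤ τ⁻¹ := by
      rw [← zpow_neg_one]
      exact zpow_le_zpow_right₀ hτ (by have := hneg m₀ hm₀; omega)
    have h5 : τ ^ (e m₀ - 1) ≤ τ⁻¹ := by
      rw [← zpow_neg_one]
      exact zpow_le_zpow_right₀ hτ (by have := hneg m₀ hm₀; omega)
    calc _ ≤ |t m₀| + |∑ m ∈ I.erase m₀, t m + R| := abs_add_le _ _
      _ ≤ b * τ⁻¹ + 5 * (b * τ⁻¹) :=
        add_le_add (h3.trans (by gcongr)) (hrest.trans (by gcongr))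
      _ = 6 * b / τ := by ring
      _ < 1 := by rw [div_lt_one hτ0]; exact h1
  have : |F| < 1 := by exact_mod_cast hlt
  exact hne (Int.abs_lt_one_iff.1 this)

/-- A variant of `intCast_ne_sum_add` in which some of the terms may vanish. -/
theorem intCast_ne_sum_fin_add {k : ℕ} (hk : k ≤ 5) {τ a b : ℝ} {t : Fin k → ℝ} {e : Fin k → ℤ}
    {R : ℝ} {E : ℤ} (hτ : 1 ≤ τ) (hb : 0 ≤ b) (he : Function.Injective e)
    (ht : ∀ m, t m = 0 ∨ a * τ ^ e m ≤ |t m| ∧ |t m| ≤ b * τ ^ e m)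
    (hneg : ∀ m, e m < 0) (hR : |R| ≤ b * τ ^ E) (hE : ∃ m, t m ≠ 0 ∧ E < e m)
    (h1 : 6 * b < τ) (h2 : 6 * b < a * τ) (F : ℤ) : (F : ℝ) ≠ ∑ m, t m + R := by
  classical
  rw [← Finset.sum_filter_ne_zero]
  refine intCast_ne_sum_add (e := e) (E := E) hτ hb ?_ he.injOn ?_ ?_ (fun m _ => hneg m) hR ?_
    h1 h2 F
  · exact (Finset.card_filter_le _ _).trans (by simpa using hk)
  · intro m hm
    exact ((ht m).resolve_left (Finset.mem_filter.1 hm).2).1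
  · intro m hm
    exact ((ht m).resolve_left (Finset.mem_filter.1 hm).2).2
  · obtain ⟨m, hm, hEm⟩ := hE
    exact ⟨m, by simpa using hm, hEm⟩

theorem exists_sign (x : ℝ) : ∃ s : ℤ, |s| = 1 ∧ (s : ℝ) * x = |x| ∧ x = s * |x| := by
  rcases le_total 0 x with h | h
  · exact ⟨1, by simp [abs_of_nonneg h]⟩
  · exact ⟨-1, by simp [abs_of_nonpos h]⟩

theorem abs_sign_mul {s : ℤ} (hs : |s| = 1) (x : ℝ) : |(s : ℝ) * x| = |x| := by
  have : |(s : ℝ)| = 1 := by exact_mod_cast hs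
  rw [abs_mul, this, one_mul]

theorem sq_sign {s : ℤ} (hs : |s| = 1) : (s : ℝ) * s = 1 := by
  have : |(s : ℝ)| = 1 := by exact_mod_cast hs
  rw [← abs_mul_abs_self, this, one_mul]

namespace HasSize

variable {l p : ℕ} {τ : ℝ}

theorem sign_mul {s : ℤ} (hs : |s| = 1) {n c : ℤ} {x : ℝ} (hx : HasSize l p τ n c x) :
    HasSize l p τ n c (s * x) := by
  rw [HasSize, abs_sign_mul hs]; exact hx

/-- Two numbers with the same growth exponent either nearly cancel or do not cancel at all. -/
theorem exists_sub_eq_add (h : IsScale l p τ) {n c c' : ℤ} {x y : ℝ}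
    (hx : HasSize l p τ n c x) (hy : HasSize l p τ n c' y) :
    ∃ g r : ℝ, x - y = g + r ∧ |r| ≤ 8 * τ ^ (n - p) ∧
      (g = 0 ∨ τ ^ n ≤ |g| ∧ |g| ≤ 4 * τ ^ n) := by
  have hpos := zpow_pos h.pos (n - p)
  rcases le_or_gt 0 (x * y) with hs | hs
  · refine ⟨0, x - y, by ring, ?_, Or.inl rfl⟩
    have h1 := hx.abs_sub_abs_le h hy
    have : |x - y| = |(|x| - |y|)| := by
      rcases mul_nonneg_iff.1 hs with ⟨ha, hb⟩ | ⟨ha, hb⟩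
      · rw [abs_of_nonneg ha, abs_of_nonneg hb]
      · rw [abs_of_nonpos ha, abs_of_nonpos hb, ← abs_neg]; ring_nf
    rwa [this]
  · refine ⟨x - y, 0, by ring, by simpa using hpos.le, Or.inr ?_⟩
    have h1 := hx.bounds h
    have h2 := hy.bounds h
    have : |x - y| = |x| + |y| := by
      rcases mul_neg_iff.1 hs with ⟨ha, hb⟩ | ⟨ha, hb⟩
      · rw [abs_of_pos ha, abs_of_neg hb, abs_of_pos (by linarith)]; ring
      · rw [abs_of_neg ha, abs_of_pos hb, abs_of_neg (by linarith)]; ring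
    rw [this]
    constructor <;> linarith

end HasSize

/-! ### Exponent patterns incompatible with integral traces -/

section Contradictions

variable {l p : ℕ} {τ : ℝ} {x y z x' y' z' : ℝ} {cx cy cz cx' cy' cz' : ℤ}

/-- As `τ^p = l`, the large conjugate is `±(l + c/p)` up to `O(1/l)`. Multiplying the trace by `p`
makes this an integer, and a fractional part of order `τ^(-1)` is left over. For `p ≥ 3` the orders
`-1` and `1 - p` differ. -/
theorem intCast_ne_of_exponents_p (h : IsScale l p τ) (hp : 3 ≤ p)
    (hx : HasSize l p τ p cx x) (hy : HasSize l p τ (-1) cy y)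
    (hz : HasSize l p τ (1 - p) cz z) (t : ℤ) : (t : ℝ) ≠ x + y + z := by
  intro ht
  obtain ⟨s, hs, hsx, -⟩ := exists_sign x
  have hp0 := h.p_pos
  have hl := h.cast_pos
  refine intCast_ne_sum_fin_add (k := 2) (by norm_num) (τ := τ) (a := p / 2) (b := 40 * p)
    (t := ![p * (s * y), p * (s * z)]) (e := ![-1, 1 - p])
    (R := p * (|x| - l * (1 + cx / (p * l)))) (E := -p) (by linarith [h.large]) (by positivity)
    ?_ ?_ ?_ ?_ ?_ (by linarith [h.le]) (by nlinarith [h.large]) (s * p * t - p * l - cx) ?_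
  · intro i j
    fin_cases i <;> fin_cases j <;> simp <;> omega
  · intro m
    right
    have key : ∀ {w : ℝ} {n c : ℤ}, HasSize l p τ n c w →
        (p : ℝ) / 2 * τ ^ n ≤ |p * (s * w)| ∧ |p * (s * w)| ≤ 40 * p * τ ^ n := by
      intro w n c hw
      rw [abs_mul, abs_sign_mul hs, abs_of_pos hp0]
      have := hw.bounds h
      have ht := zpow_pos h.pos n
      constructor
      · nlinarith
      · nlinarith
    fin_cases m
    · exact key hy
    · exact key hz
  · intro m
    fin_cases m <;> simp; omega
  · have h2 := hx.2
    rw [zpow_natCast, h.pow_eq] at h2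
    rw [abs_mul, abs_of_pos hp0, zpow_neg, zpow_natCast, h.pow_eq]
    calc (p : ℝ) * _ ≤ p * (40 * l / (l : ℝ) ^ 2) := by gcongr
      _ = 40 * p * (l : ℝ)⁻¹ := by field_simp
  · refine ⟨0, ?_, ?_⟩
    · have := (hy.sign_mul hs).ne_zero h
      simpa [hp0.ne'] using this
    · simp; omega
  · rw [Fin.sum_univ_two]
    simp only [Matrix.cons_val_zero, Matrix.cons_val_one]
    push_cast
    rw [ht, ← hsx]
    field_simp
    ring

/-- The integer `2 t₂ - t²` equals `(x - y)² + z² - 2 z (x + y)`. Equal signs make `x - y` small and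
prevent cancellation in `x + y`, so the last term, of order `τ^(-m)`, dominates; `3 m < 2 p` is what
bounds `(x - y)²`. -/
theorem false_of_exponents_double (h : IsScale l p τ) {m : ℤ} (hm : 0 < m) (hmp : 3 * m < 2 * p)
    (hx : HasSize l p τ m cx x) (hy : HasSize l p τ m cy y) (hz : HasSize l p τ (-2 * m) cz z)
    (hxy : 0 < x * y) {t t₂ : ℤ} (ht : (t : ℝ) = x + y + z)
    (ht₂ : (t₂ : ℝ) = x ^ 2 + y ^ 2 + z ^ 2) : False := by
  have hτ := h.large
  have h1 := hx.bounds h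
  have h2 := hy.bounds h
  have h3 := hz.bounds h
  have hxy' : |x + y| = |x| + |y| := by
    rcases mul_pos_iff.1 hxy with ⟨ha, hb⟩ | ⟨ha, hb⟩
    · rw [abs_of_pos ha, abs_of_pos hb, abs_of_pos (by linarith)]
    · rw [abs_of_neg ha, abs_of_neg hb, abs_of_neg (by linarith)]; ring
  have hd : |x - y| = |(|x| - |y|)| := by
    rcases mul_pos_iff.1 hxy with ⟨ha, hb⟩ | ⟨ha, hb⟩
    · rw [abs_of_pos ha, abs_of_pos hb]
    · rw [abs_of_neg ha, abs_of_neg hb, ← abs_neg]; ring_nf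
  have hdiff := hx.abs_sub_abs_le h hy
  rw [← hd] at hdiff
  have hmain : τ ^ m * τ ^ (-2 * m) = τ ^ (-m) := by
    rw [← zpow_add₀ h.pos.ne']; ring_nf
  refine intCast_ne_sum_fin_add (k := 1) (by norm_num) (τ := τ) (a := 1) (b := 80)
    (t := ![-2 * z * (x + y)]) (e := ![-m])
    (R := (x - y) ^ 2 + z ^ 2) (E := -m - 1) (by linarith) (by norm_num)
    ?_ ?_ ?_ ?_ ?_ (by linarith) (by linarith) (2 * t₂ - t ^ 2) ?_
  · exact Function.injective_of_subsingleton _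
  · intro i
    right
    fin_cases i
    simp only [Fin.zero_eta, Matrix.cons_val_zero]
    rw [abs_mul, abs_mul, hxy', ← hmain]
    have e : |(-2 : ℝ)| = 2 := by norm_num
    rw [e]
    have p1 := zpow_pos h.pos m
    have p2 := zpow_pos h.pos (-2 * m)
    constructor
    · calc 1 * (τ ^ m * τ ^ (-2 * m)) = 2 * (τ ^ (-2 * m) / 2) * (τ ^ m / 2 + τ ^ m / 2) := by ring
        _ ≤ 2 * |z| * (|x| + |y|) := by
          gcongr
          · exact h3.1
          · exact h1.1
          · exact h2.1
    · calc 2 * |z| * (|x| + |y|) ≤ 2 * (2 * τ ^ (-2 * m)) * (2 * τ ^ m + 2 * τ ^ m) := by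
            gcongr
            · exact h3.2
            · exact h1.2
            · exact h2.2
        _ ≤ 80 * (τ ^ m * τ ^ (-2 * m)) := by nlinarith [mul_pos p1 p2]
  · intro i
    fin_cases i
    simpa using hm
  · rw [abs_of_nonneg (by positivity), ← sq_abs (x - y), ← sq_abs z]
    have a1 : |x - y| ^ 2 ≤ 64 * τ ^ (-m - 1) := by
      calc |x - y| ^ 2 ≤ (8 * τ ^ (m - p)) ^ 2 := by gcongr
        _ = 64 * τ ^ (2 * (m - p)) := by
          rw [mul_pow, ← zpow_natCast (τ ^ (m - (p : ℤ))), ← zpow_mul]; ring_nf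
        _ ≤ 64 * τ ^ (-m - 1) := by
          gcongr
          · linarith
          · omega
    have a2 : |z| ^ 2 ≤ 4 * τ ^ (-m - 1) := by
      calc |z| ^ 2 ≤ (2 * τ ^ (-2 * m)) ^ 2 := by
            gcongr
            exact h3.2
        _ = 4 * τ ^ (-4 * m) := by
          rw [mul_pow, ← zpow_natCast (τ ^ (-2 * m)), ← zpow_mul]; ring_nf
        _ ≤ 4 * τ ^ (-m - 1) := by
          gcongr
          · linarith
          · omega
    have := zpow_pos h.pos (-m - 1)
    linarith
  · refine ⟨0, ?_, by simp⟩
    have hz0 := hz.ne_zero h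
    have hxy0 : x + y ≠ 0 := by
      rw [← abs_pos, hxy']
      have := abs_pos.2 (hx.ne_zero h)
      positivity
    simp [hz0, hxy0]
  · rw [Fin.sum_univ_one]
    push_cast
    rw [ht, ht₂]
    ring

/-- With opposite signs the leading terms of `x` and `y` cancel, but their second-order coefficients
`0` and `1` leave a term of absolute value `τ^(-1)/2`, larger than `z`. -/
theorem intCast_ne_of_exponents_two (h : IsScale l 2 τ)
    (hx : HasSize l 2 τ 1 0 x) (hy : HasSize l 2 τ 1 1 y) (hz : HasSize l 2 τ (-2) cz z)
    (hxy : x * y < 0) (t : ℤ) : (t : ℝ) ≠ x + y + z := by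
  intro ht
  have hτ := h.large
  obtain ⟨s, hs, hsx, hsx'⟩ := exists_sign x
  have hsy : (s : ℝ) * y = -|y| := by
    rcases mul_neg_iff.1 hxy with ⟨ha, hb⟩ | ⟨ha, hb⟩
    · rw [abs_of_pos ha] at hsx
      have : (s : ℝ) = 1 := mul_right_cancel₀ ha.ne' (by linarith)
      rw [this, abs_of_neg hb]; ring
    · rw [abs_of_neg ha] at hsx
      have : (s : ℝ) = -1 := mul_right_cancel₀ ha.ne (by linarith)
      rw [this, abs_of_pos hb]; ring
  have h1 := hx.abs_sub_abs h hy
  norm_num at h1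
  have h3 := (hz.bounds h).2
  refine intCast_ne_sum_fin_add (k := 1) (by norm_num) (τ := τ) (a := 1 / 2) (b := 90)
    (t := ![-(1 / 2) * τ ^ (-1 : ℤ)]) (e := ![-1])
    (R := (|x| - |y| + 1 / 2 * τ ^ (-1 : ℤ)) + s * z) (E := -2) (by linarith) (by norm_num)
    ?_ ?_ ?_ ?_ ?_ (by linarith) (by linarith) (s * t) ?_
  · exact Function.injective_of_subsingleton _
  · intro i
    right
    fin_cases i
    have := zpow_pos h.pos (-1)
    simp only [Fin.zero_eta, Matrix.cons_val_zero]
    rw [abs_mul, abs_of_pos this]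
    norm_num
    have := inv_pos.2 h.pos
    linarith
  · intro i
    fin_cases i
    simp
  · refine (abs_add_le _ _).trans ?_
    rw [abs_sign_mul hs]
    have := h.zpow_le_zpow (show (-3 : ℤ) ≤ -2 by norm_num)
    have e : |x| - |y| + 1 / 2 * τ ^ (-1 : ℤ) = |x| - |y| + 1 / 2 * τ⁻¹ := by simp
    rw [e]
    have e' : (τ ^ 3)⁻¹ = τ ^ (-3 : ℤ) := by rw [zpow_neg]; norm_cast
    rw [e'] at h1
    have := zpow_pos h.pos (-2)
    linarith
  · refine ⟨0, ?_, by simp⟩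
    have := h.pos.ne'
    simp [this]
  · rw [Fin.sum_univ_one]
    push_cast
    rw [ht, mul_add, mul_add, hsx, hsy]
    ring

/-- Subtracting two conjugates with the same positive exponent, after adjusting the sign. -/
theorem exists_sign_sub (h : IsScale l p τ) {n : ℤ} (hx : HasSize l p τ n cx x)
    (hx' : HasSize l p τ n cx' x') :
    ∃ s s' : ℤ, |s| = 1 ∧ |s'| = 1 ∧
      |x - s * x' - s' * ((cx - cx' : ℤ) / p * τ ^ (n - p))| ≤ 80 * τ ^ (n - 2 * p) := by
  obtain ⟨s₁, hs₁, -, h₁⟩ := exists_sign x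
  obtain ⟨s₂, hs₂, h₂, -⟩ := exists_sign x'
  refine ⟨s₁ * s₂, s₁, by rw [abs_mul, hs₁, hs₂, one_mul], hs₁, ?_⟩
  have e : x - ((s₁ * s₂ : ℤ) : ℝ) * x' - s₁ * ((cx - cx' : ℤ) / p * τ ^ (n - p)) =
      s₁ * (|x| - |x'| - ((cx - cx' : ℤ) : ℝ) / p * τ ^ (n - p)) := by
    rw [← h₂]
    push_cast
    linear_combination h₁
  rw [e, abs_sign_mul hs₁]
  exact hx.abs_sub_abs h hx'

theorem coeff_term_bounds (h : IsScale l p τ) {n c c' s : ℤ} (hc : |(c : ℝ)| ≤ 3 * p)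
    (hc' : |(c' : ℝ)| ≤ 3 * p) (hs : |s| = 1) (hne : c - c' ≠ 0) :
    1 / (p : ℝ) * τ ^ n ≤ |s * (((c - c' : ℤ) : ℝ) / p * τ ^ n)| ∧
      |s * (((c - c' : ℤ) : ℝ) / p * τ ^ n)| ≤ 6 * τ ^ n := by
  have hp := h.p_pos
  have ht := zpow_pos h.pos n
  rw [abs_sign_mul hs, abs_mul, abs_of_pos ht, abs_div, abs_of_pos hp]
  constructor
  · gcongr
    exact_mod_cast Int.one_le_abs hne
  · gcongr
    rw [div_le_iff₀ hp]
    push_cast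
    exact (abs_sub _ _).trans (by linarith)

theorem size_term_bounds (h : IsScale l p τ) {n c : ℤ} {b : ℝ} (hb : 2 ≤ b)
    (hx : HasSize l p τ n c x) : 1 / (p : ℝ) * τ ^ n ≤ |x| ∧ |x| ≤ b * τ ^ n := by
  have hp : (2 : ℝ) ≤ p := by exact_mod_cast h.two_le
  have ht := zpow_pos h.pos n
  have hb' := hx.bounds h
  constructor
  · refine le_trans ?_ hb'.1
    have : 1 / (p : ℝ) ≤ 1 / 2 := one_div_le_one_div_of_le (by norm_num) hp
    calc 1 / (p : ℝ) * τ ^ n ≤ 1 / 2 * τ ^ n := by gcongr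
      _ = τ ^ n / 2 := by ring
  · exact hb'.2.trans (by gcongr)

/-- For a suitable sign `s`, the large parts of `x` and `s x'` cancel in `t - s t'`, leaving at most
order `X - p`. Five distinct negative orders remain. -/
theorem false_of_exponents_distinct (h : IsScale l p τ) {X ny nz ny' nz' : ℤ} (hXp : X < p)
    (hy0 : ny < 0) (hz0 : nz < 0) (hy0' : ny' < 0) (hz0' : nz' < 0) (hyp : -p < ny)
    (hinj : Function.Injective ![X - p, ny, nz, ny', nz'])
    (hx : HasSize l p τ X cx x) (hy : HasSize l p τ ny cy y) (hz : HasSize l p τ nz cz z)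
    (hx' : HasSize l p τ X cx' x') (hy' : HasSize l p τ ny' cy' y')
    (hz' : HasSize l p τ nz' cz' z') {t t' : ℤ} (ht : (t : ℝ) = x + y + z)
    (ht' : (t' : ℝ) = x' + y' + z') : False := by
  have hp := h.p_pos
  have hτ := h.large
  obtain ⟨s, s', hs, hs', hd⟩ := exists_sign_sub h hx hx'
  have hs0 : |-s| = 1 := by rwa [abs_neg]
  refine intCast_ne_sum_fin_add (k := 5) le_rfl (τ := τ) (a := 1 / p) (b := 80)
    (t := ![s' * ((cx - cx' : ℤ) / p * τ ^ (X - p)), y, z, (-s : ℤ) * y', (-s : ℤ) * z'])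
    (R := x - s * x' - s' * ((cx - cx' : ℤ) / p * τ ^ (X - p))) (E := X - 2 * p)
    (by linarith) (by norm_num) hinj ?_ ?_ hd ?_ (by linarith) ?_ (t - s * t') ?_
  · intro m
    fin_cases m
    · rcases eq_or_ne (cx - cx') 0 with h0 | h0
      · left; simp [h0]
      · right
        have := coeff_term_bounds (n := X - p) h hx.1 hx'.1 hs' h0
        refine ⟨this.1, this.2.trans ?_⟩
        have := zpow_pos h.pos (X - p)
        simp only [Fin.zero_eta, Matrix.cons_val_zero]
        linarith
    · exact Or.inr (size_term_bounds h (by norm_num) hy)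
    · exact Or.inr (size_term_bounds h (by norm_num) hz)
    · exact Or.inr (size_term_bounds h (by norm_num) (hy'.sign_mul hs0))
    · exact Or.inr (size_term_bounds h (by norm_num) (hz'.sign_mul hs0))
  · intro m
    fin_cases m <;> simp <;> omega
  -- The first term vanishes when `cx = cx'`, so `y` is used as the term that outweighs the error:
  -- `X - 2 p < -p < ny`.
  · refine ⟨1, hy.ne_zero h, ?_⟩
    simp only [Matrix.cons_val_one, Matrix.cons_val_zero]
    omega
  · rw [div_mul_eq_mul_div, lt_div_iff₀ hp]; linarith [h.le]
  · rw [Fin.sum_univ_five]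
    push_cast
    rw [ht, ht']
    ring

/-- Here the small conjugates share their orders pairwise and may cancel as well. Each pair
contributes either a full term or a remainder below order `X - p`, so `cx ≠ cx'` is needed to
guarantee a surviving term. -/
theorem false_of_exponents_cyclic (h : IsScale l p τ) {X Y Z : ℤ} (hX0 : 0 < X) (hXp : X < p)
    (hY0 : 0 < Y) (hZ0 : 0 < Z) (hinj : Function.Injective ![X - p, -Y, -Z])
    (hc : cx - cx' ≠ 0)
    (hx : HasSize l p τ X cx x) (hy : HasSize l p τ (-Y) cy y) (hz : HasSize l p τ (-Z) cz z)
    (hx' : HasSize l p τ X cx' x') (hy' : HasSize l p τ (-Y) cy' y')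
    (hz' : HasSize l p τ (-Z) cz' z') {t t' : ℤ} (ht : (t : ℝ) = x + y + z)
    (ht' : (t' : ℝ) = x' + y' + z') : False := by
  have hp := h.p_pos
  have hτ := h.large
  obtain ⟨s, s', hs, hs', hd⟩ := exists_sign_sub h hx hx'
  obtain ⟨g, r, hgr, hr, hg⟩ := hy.exists_sub_eq_add h (hy'.sign_mul hs)
  obtain ⟨g', r', hgr', hr', hg'⟩ := hz.exists_sub_eq_add h (hz'.sign_mul hs)
  have hp1 : (1 : ℝ) / p ≤ 1 := by
    rw [div_le_one hp]; exact_mod_cast (by have := h.two_le; omega : 1 ≤ p)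
  refine intCast_ne_sum_fin_add (k := 3) (by norm_num) (τ := τ) (a := 1 / p) (b := 100)
    (t := ![s' * ((cx - cx' : ℤ) / p * τ ^ (X - p)), g, g'])
    (R := (x - s * x' - s' * ((cx - cx' : ℤ) / p * τ ^ (X - p))) + r + r') (E := X - p - 1)
    (by linarith) (by norm_num) hinj ?_ ?_ ?_ ?_ (by linarith) ?_ (t - s * t') ?_
  · have key : ∀ {g : ℝ} {n : ℤ}, (g = 0 ∨ τ ^ n ≤ |g| ∧ |g| ≤ 4 * τ ^ n) →
        (g = 0 ∨ 1 / (p : ℝ) * τ ^ n ≤ |g| ∧ |g| ≤ 100 * τ ^ n) := by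
      rintro g n (h0 | ⟨h1, h2⟩)
      · exact Or.inl h0
      · have := zpow_pos h.pos n
        exact Or.inr ⟨(mul_le_of_le_one_left this.le hp1).trans h1, by linarith⟩
    intro m
    fin_cases m
    · right
      have := coeff_term_bounds (n := X - p) h hx.1 hx'.1 hs' hc
      refine ⟨this.1, this.2.trans ?_⟩
      have := zpow_pos h.pos (X - p)
      simp only [Fin.zero_eta, Matrix.cons_val_zero]
      linarith
    · exact key hg
    · exact key hg'
  · intro m
    fin_cases m <;> simp <;> omega
  · have e1 := h.zpow_le_zpow (show X - 2 * p ≤ X - p - 1 by have := h.two_le; omega)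
    have e2 := h.zpow_le_zpow (show -Y - p ≤ X - p - 1 by omega)
    have e3 := h.zpow_le_zpow (show -Z - p ≤ X - p - 1 by omega)
    have := zpow_pos h.pos (X - p - 1)
    refine (abs_add_le _ _).trans ?_
    have := abs_add_le (x - s * x' - s' * (((cx - cx' : ℤ) : ℝ) / p * τ ^ (X - p))) r
    linarith
  · refine ⟨0, ?_, by simp⟩
    have := (coeff_term_bounds (n := X - p) h hx.1 hx'.1 hs' hc).1
    have h3 := zpow_pos h.pos (X - p)
    have : 0 < 1 / (p : ℝ) * τ ^ (X - p) := by positivity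
    simp only [Matrix.cons_val_zero]
    exact abs_pos.1 (by linarith)
  · rw [div_mul_eq_mul_div, lt_div_iff₀ hp]; linarith [h.le]
  · rw [Fin.sum_univ_three]
    push_cast
    rw [ht, ht']
    linear_combination hgr + hgr'

end Contradictions

/-! ### Exponent vectors of units -/

namespace IsEnnolaRoots

variable {l : ℕ} {θ : Fin 3 → ℝ}

theorem emb_unit (h : IsEnnolaRoots l θ) (i : Fin 3) :
    h.emb i (ennolaUnit l : EnnolaField l) = θ i := h.emb_root i

theorem emb_unitSubOne (h : IsEnnolaRoots l θ) (i : Fin 3) :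
    h.emb i (ennolaUnitSubOne l : EnnolaField l) = θ i - 1 := by
  change h.emb i (algebraMap (𝓞 (EnnolaField l)) (EnnolaField l) (ennolaInt l - 1)) = θ i - 1
  rw [map_sub, map_sub, map_one, map_one]
  congr 1
  exact h.emb_root i

theorem emb_unit_ne_zero (h : IsEnnolaRoots l θ) (i : Fin 3) (u : (𝓞 (EnnolaField l))ˣ) :
    h.emb i (u : EnnolaField l) ≠ 0 :=
  (_root_.map_ne_zero _).2 (Units.coe_ne_zero u)

theorem emb_zpow_mul_zpow (h : IsEnnolaRoots l θ) (i : Fin 3) (a b : ℤ) :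
    h.emb i ((ennolaUnit l ^ a * ennolaUnitSubOne l ^ b : (𝓞 (EnnolaField l))ˣ) :
      EnnolaField l) = θ i ^ a * (θ i - 1) ^ b := by
  rw [Units.coe_mul, Units.coe_zpow, Units.coe_zpow, map_mul, map_zpow₀, map_zpow₀, h.emb_unit,
    h.emb_unitSubOne]

end IsEnnolaRoots

/-- The unit `u` is, up to sign, a `p`-th root of the element of `⟨ε_l, ε_l - 1⟩` whose conjugates
grow like the powers of `l` with exponents `n 0`, `n 1`, `n 2`. -/
def HasExponents {l : ℕ} (p : ℕ) (u : (𝓞 (EnnolaField l))ˣ) (n : Fin 3 → ℤ) : Prop :=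
  n 0 + n 1 + n 2 = 0 ∧ (u ^ p = ennolaUnit l ^ (-n 0) * ennolaUnitSubOne l ^ (-n 1) ∨
    u ^ p = -(ennolaUnit l ^ (-n 0) * ennolaUnitSubOne l ^ (-n 1)))

/-- The coefficients of `1 / (p * l)` in the logarithms of the conjugates of a unit with growth
exponents `n`. -/
def coeffExponents (n : Fin 3 → ℤ) (i : Fin 3) : ℤ :=
  -n 0 * coeffRoot i + -n 1 * coeffSubOne i

namespace HasExponents

variable {l p : ℕ} {θ : Fin 3 → ℝ} {τ : ℝ} {u : (𝓞 (EnnolaField l))ˣ} {n : Fin 3 → ℤ}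

theorem sq_pow_eq (hu : HasExponents p u n) :
    (u ^ p) ^ 2 = (ennolaUnit l ^ (-n 0) * ennolaUnitSubOne l ^ (-n 1)) ^ 2 := by
  rcases hu.2 with h | h <;> rw [h]
  rw [neg_sq]

theorem abs_emb_pow (hu : HasExponents p u n) (h : IsEnnolaRoots l θ) (i : Fin 3) :
    |h.emb i (u : EnnolaField l)| ^ p = |θ i| ^ (-n 0) * |θ i - 1| ^ (-n 1) := by
  have h1 : (h.emb i (u : EnnolaField l) ^ p) ^ 2 = (θ i ^ (-n 0) * (θ i - 1) ^ (-n 1)) ^ 2 := by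
    have := congrArg (fun v : (𝓞 (EnnolaField l))ˣ => h.emb i (v : EnnolaField l)) hu.sq_pow_eq
    simpa only [Units.coe_pow, map_pow, h.emb_zpow_mul_zpow] using this
  rw [← abs_pow, ← abs_zpow, ← abs_zpow, ← abs_mul]
  exact (sq_eq_sq_iff_abs_eq_abs _ _).1 h1

/-- The logarithmic asymptotics of `θ` and `θ - 1` combine linearly with weights `-n 0`, `-n 1`; at
the third place the main term is `n 2` because `n` has sum zero. The bound on `n` keeps the
coefficient and the error proportional to `p`. -/
theorem hasSize (hu : HasExponents p u n) (h : IsLocatedRoots l θ) (hs : IsScale l p τ)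
    (hn : ∀ i, |n i| ≤ p) (i : Fin 3) :
    HasSize l p τ (n i) (coeffExponents n i)
      ((h.isEnnolaRoots hs.three_le).emb i (u : EnnolaField l)) := by
  set H := h.isEnnolaRoots hs.three_le with hH
  have hn' : ∀ i, |(n i : ℝ)| ≤ p := fun i => by exact_mod_cast hn i
  have hp := hs.p_pos
  have hl := hs.cast_pos
  have hθ : θ i ≠ 0 := by intro h0; have := h.root i; simp [h0] at this
  have hθ' : θ i - 1 ≠ 0 := by intro h0; have := h.root i; simp [h0] at this
  have hlog : p * Real.log |H.emb i (u : EnnolaField l)| =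
      -n 0 * Real.log |θ i| + -n 1 * Real.log |θ i - 1| := by
    have := congrArg Real.log (hu.abs_emb_pow H i)
    rw [Real.log_pow, Real.log_mul (zpow_ne_zero _ (abs_ne_zero.2 hθ))
      (zpow_ne_zero _ (abs_ne_zero.2 hθ')), Real.log_zpow, Real.log_zpow] at this
    push_cast at this
    exact this
  refine hasSize_of_log hs (H.emb_unit_ne_zero i u) ?_ ?_
  · have a1 : |(coeffRoot i : ℝ)| ≤ 1 := by fin_cases i <;> simp [coeffRoot]
    have a2 : |(coeffSubOne i : ℝ)| ≤ 2 := by fin_cases i <;> simp [coeffSubOne]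
    rw [coeffExponents]
    push_cast
    calc |(-(n 0 : ℝ)) * coeffRoot i + -(n 1) * coeffSubOne i|
        ≤ |(n 0 : ℝ)| * |(coeffRoot i : ℝ)| + |(n 1 : ℝ)| * |(coeffSubOne i : ℝ)| := by
          refine (abs_add_le _ _).trans ?_
          rw [abs_mul, abs_mul, abs_neg, abs_neg]
      _ ≤ p * 1 + p * 2 := by
          gcongr
          · exact hn' 0
          · exact hn' 1
      _ = 3 * p := by ring
  · obtain ⟨b1, b2⟩ := h.abs_log_bounds hs.three_le i
    have hexp : (n i : ℝ) = -n 0 * expRoot i + -n 1 * expSubOne i := by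
      have h0 := hu.1
      have : n i = -n 0 * expRoot i + -n 1 * expSubOne i := by
        fin_cases i <;> simp [expRoot, expSubOne]
        omega
      rw [this]
      push_cast
      rfl
    have e : p * Real.log |H.emb i (u : EnnolaField l)| -
        (n i * Real.log l + coeffExponents n i / l) =
        -n 0 * (Real.log |θ i| - (expRoot i * Real.log l + coeffRoot i / l)) +
        -n 1 * (Real.log |θ i - 1| - (expSubOne i * Real.log l + coeffSubOne i / l)) := by
      rw [hlog, hexp, coeffExponents]
      push_cast
      ring
    rw [e]
    refine (abs_add_le _ _).trans ?_
    rw [abs_mul, abs_mul, abs_neg, abs_neg]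
    calc |(n 0 : ℝ)| * _ + |(n 1 : ℝ)| * _
        ≤ p * (10 / (l : ℝ) ^ 2) + p * (10 / (l : ℝ) ^ 2) := by
          gcongr
          · exact hn' 0
          · exact hn' 1
      _ = 20 * p / (l : ℝ) ^ 2 := by ring

theorem zpow_eq (hu : HasExponents p u n) (κ : ℤ) :
    (u ^ κ) ^ p = ennolaUnit l ^ (-(κ * n 0)) * ennolaUnitSubOne l ^ (-(κ * n 1)) ∨
    (u ^ κ) ^ p = -(ennolaUnit l ^ (-(κ * n 0)) * ennolaUnitSubOne l ^ (-(κ * n 1))) := by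
  have e : ∀ v : (𝓞 (EnnolaField l))ˣ, (v ^ κ) ^ p = (v ^ p) ^ κ := fun v => by
    rw [← zpow_natCast, ← zpow_natCast, zpow_comm]
  have e2 : (ennolaUnit l ^ (-n 0) * ennolaUnitSubOne l ^ (-n 1)) ^ κ =
      ennolaUnit l ^ (-(κ * n 0)) * ennolaUnitSubOne l ^ (-(κ * n 1)) := by
    rw [mul_zpow, ← zpow_mul, ← zpow_mul]
    congr 2 <;> ring
  rw [e]
  rcases hu.2 with h | h
  · left; rw [h, e2]
  · rw [h, ← e2]
    rcases Int.even_or_odd κ with hk | hk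
    · left; exact hk.neg_zpow _
    · right; exact hk.neg_zpow _

/-- Every exponent vector which is congruent modulo `p` to a multiple of that of a unit is the
exponent vector of a unit. -/
theorem exists_of_dvd (hu : HasExponents p u n) (κ : ℤ) {m : Fin 3 → ℤ}
    (hm : m 0 + m 1 + m 2 = 0) (hdvd : ∀ i, (p : ℤ) ∣ κ * n i - m i) :
    ∃ v : (𝓞 (EnnolaField l))ˣ, HasExponents p v m := by
  obtain ⟨a, ha⟩ := hdvd 0
  obtain ⟨b, hb⟩ := hdvd 1
  refine ⟨u ^ κ * (ennolaUnit l ^ a * ennolaUnitSubOne l ^ b), hm, ?_⟩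
  have e : (ennolaUnit l ^ (-(κ * n 0)) * ennolaUnitSubOne l ^ (-(κ * n 1))) *
      (ennolaUnit l ^ a * ennolaUnitSubOne l ^ b) ^ p =
      ennolaUnit l ^ (-m 0) * ennolaUnitSubOne l ^ (-m 1) := by
    rw [mul_pow, ← zpow_natCast, ← zpow_natCast, ← zpow_mul, ← zpow_mul, mul_mul_mul_comm,
      ← zpow_add, ← zpow_add]
    congr 2
    · linear_combination -ha
    · linear_combination -hb
  rw [mul_pow]
  rcases hu.zpow_eq κ with h | h
  · left; rw [h, e]
  · right; rw [h, neg_mul, e]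

theorem sq (hu : HasExponents p u n) : HasExponents p (u ^ 2) (fun i => 2 * n i) := by
  refine ⟨by have := hu.1; linarith, Or.inl ?_⟩
  rw [pow_right_comm, hu.sq_pow_eq, mul_pow, ← zpow_natCast, ← zpow_natCast, ← zpow_mul,
    ← zpow_mul]
  congr 2 <;> push_cast <;> ring

end HasExponents

/-! ### Finiteness of the index and extraction of a `p`-th root -/

section Index

variable {l : ℕ} {θ : Fin 3 → ℝ}

/-- The group generated by `-1`, `ε_l` and `ε_l - 1`. -/
noncomputable abbrev ennolaSubgroup (l : ℕ) : Subgroup (𝓞 (EnnolaField l))ˣ :=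
  Subgroup.closure {-1, ennolaUnit l, ennolaUnitSubOne l}

theorem neg_one_mem_ennolaSubgroup (l : ℕ) : -1 ∈ ennolaSubgroup l :=
  Subgroup.subset_closure (by simp)

theorem zpow_mul_zpow_mem_ennolaSubgroup (l : ℕ) (a b : ℤ) :
    ennolaUnit l ^ a * ennolaUnitSubOne l ^ b ∈ ennolaSubgroup l :=
  mul_mem (zpow_mem (Subgroup.subset_closure (by simp)) a)
    (zpow_mem (Subgroup.subset_closure (by simp)) b)

theorem exists_of_mem_ennolaSubgroup {x : (𝓞 (EnnolaField l))ˣ} (hx : x ∈ ennolaSubgroup l) :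
    ∃ a b : ℤ, x = ennolaUnit l ^ a * ennolaUnitSubOne l ^ b ∨
      x = -(ennolaUnit l ^ a * ennolaUnitSubOne l ^ b) := by
  induction hx using Subgroup.closure_induction with
  | mem x hx =>
    rcases hx with rfl | rfl | rfl
    · exact ⟨0, 0, by simp⟩
    · exact ⟨1, 0, by simp⟩
    · exact ⟨0, 1, by simp⟩
  | one => exact ⟨0, 0, by simp⟩
  | mul x y _ _ hx hy =>
    obtain ⟨a, b, hx⟩ := hx
    obtain ⟨c, d, hy⟩ := hy
    refine ⟨a + c, b + d, ?_⟩
    rw [zpow_add, zpow_add, mul_mul_mul_comm]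
    rcases hx with rfl | rfl <;> rcases hy with rfl | rfl <;> simp
  | inv x _ hx =>
    obtain ⟨a, b, hx⟩ := hx
    refine ⟨-a, -b, ?_⟩
    rcases hx with rfl | rfl
    · left; rw [mul_inv, zpow_neg, zpow_neg]
    · right; rw [inv_neg, mul_inv, zpow_neg, zpow_neg]

/-- The field has odd degree, so its only roots of unity are `±1`. -/
theorem mem_ennolaSubgroup_of_pow_eq_one {ζ : (𝓞 (EnnolaField l))ˣ} {k : ℕ} (hk : 0 < k)
    (hζ : ζ ^ k = 1) : ζ ∈ ennolaSubgroup l := by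
  have ht : ζ ∈ Units.torsion (EnnolaField l) :=
    (CommGroup.mem_torsion _).2 (isOfFinOrder_iff_pow_eq_one.2 ⟨k, hk, hζ⟩)
  have hodd : Odd (Module.finrank ℚ (EnnolaField l)) := by
    rw [finrank_ennolaField]; decide
  rcases Units.torsion_eq_one_or_neg_one_of_odd_finrank hodd ⟨ζ, ht⟩ with h | h
  · rw [show ζ = 1 from h]; exact one_mem _
  · rw [show ζ = -1 from h]; exact neg_one_mem_ennolaSubgroup l

/-- The logarithmic embedding omits one place; the relation there is recovered because the weighted
logarithms of a unit sum to zero over all places. -/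
theorem IsEnnolaRoots.mul_log_add_mul_log_eq_zero (h : IsEnnolaRoots l θ) {s t : ℝ}
    (hst : s • Units.logEmbedding (EnnolaField l) (Additive.ofMul (ennolaUnit l)) +
      t • Units.logEmbedding (EnnolaField l) (Additive.ofMul (ennolaUnitSubOne l)) = 0)
    (i : Fin 3) : s * Real.log |θ i| + t * Real.log |θ i - 1| = 0 := by
  classical
  set g : InfinitePlace (EnnolaField l) → ℝ := fun w =>
    s * (w.mult * Real.log (w (ennolaUnit l : EnnolaField l))) +
      t * (w.mult * Real.log (w (ennolaUnitSubOne l : EnnolaField l))) with hg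
  have hsum : ∑ w, g w = 0 := by
    simp only [hg]
    rw [Finset.sum_add_distrib, ← Finset.mul_sum, ← Finset.mul_sum, Units.sum_mult_mul_log,
      Units.sum_mult_mul_log, mul_zero, mul_zero, add_zero]
  have hne : ∀ w, w ≠ Units.dirichletUnitTheorem.w₀ → g w = 0 := by
    intro w hw
    have := congrFun hst ⟨w, hw⟩
    simpa only [Pi.add_apply, Pi.smul_apply, smul_eq_mul, Pi.zero_apply,
      Units.dirichletUnitTheorem.logEmbedding_component] using this
  have hall : ∀ w, g w = 0 := by
    intro w
    by_cases hw : w = Units.dirichletUnitTheorem.w₀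
    · rw [Finset.sum_eq_single w (fun w' _ h' => hne w' (hw ▸ h')) (by simp)] at hsum
      exact hsum
    · exact hne w hw
  have hi := hall (InfinitePlace.mk (h.cemb i : EnnolaField l →+* ℂ))
  have hv : ∀ x : EnnolaField l,
      InfinitePlace.mk (h.cemb i : EnnolaField l →+* ℂ) x = |h.emb i x| := by
    intro x
    rw [InfinitePlace.apply]
    change ‖((h.emb i x : ℝ) : ℂ)‖ = _
    rw [Complex.norm_real, Real.norm_eq_abs]
  simp only [hg] at hi
  rw [hv, hv, h.emb_unit, h.emb_unitSubOne] at hi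
  have hm : ((InfinitePlace.mk (h.cemb i : EnnolaField l →+* ℂ)).mult : ℝ) ≠ 0 := by
    exact_mod_cast InfinitePlace.mult_ne_zero
  refine (mul_eq_zero.1 ?_).resolve_left hm
  linear_combination hi

/-- The two units are independent, hence of maximal rank. Finiteness matters because an infinite
index has the value `0`, which every prime divides. -/
theorem IsLocatedRoots.finiteIndex (h : IsLocatedRoots l θ) (hl : 3 ≤ l) :
    (ennolaSubgroup l).FiniteIndex := by
  have H := h.isEnnolaRoots hl
  have hr := H.rank_eq_two
  set u : Fin (Units.rank (EnnolaField l)) → (𝓞 (EnnolaField l))ˣ :=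
    ![ennolaUnit l, ennolaUnitSubOne l] ∘ Fin.cast hr with hu
  have hmax : Units.IsMaxRank u := by
    have : LinearIndependent ℝ
        ![Units.logEmbedding (EnnolaField l) (Additive.ofMul (ennolaUnit l)),
          Units.logEmbedding (EnnolaField l) (Additive.ofMul (ennolaUnitSubOne l))] := by
      rw [LinearIndependent.pair_iff]
      intro s t hst
      have e0 := H.mul_log_add_mul_log_eq_zero hst 0
      have e2 := H.mul_log_add_mul_log_eq_zero hst 2
      have hl' : (3 : ℝ) ≤ l := by exact_mod_cast hl
      have a1 := h.lower_zero
      have a2 := h.upper_zero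
      have a3 := h.upper_two
      have b1 : 1 / (l : ℝ) < 1 := by rw [div_lt_one (by linarith)]; linarith
      have b2 : 0 < 1 / ((l : ℝ) + 1) := by positivity
      have b3 : 1 / (l : ℝ) ^ 2 < 1 := by rw [div_lt_one (by positivity)]; nlinarith
      have c1 : Real.log |θ 0| < 0 := by
        rw [abs_of_neg (by linarith)]
        exact Real.log_neg (by linarith) (by linarith)
      have c2 : 0 < Real.log |θ 0 - 1| := by
        rw [abs_of_neg (by linarith)]
        exact Real.log_pos (by linarith)
      have c3 : 0 < Real.log |θ 2| := by
        rw [abs_of_neg (by linarith)]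
        exact Real.log_pos (by linarith)
      have c4 : 0 < Real.log |θ 2 - 1| := by
        rw [abs_of_neg (by linarith)]
        exact Real.log_pos (by linarith)
      have hs : s = 0 := by
        -- The determinant of logarithms at the places `0` and `2` is negative, since only `log |θ
        -- 0|` is negative among its entries.
        have e : s * (Real.log |θ 0| * Real.log |θ 2 - 1| -
            Real.log |θ 2| * Real.log |θ 0 - 1|) = 0 := by
          linear_combination Real.log |θ 2 - 1| * e0 - Real.log |θ 0 - 1| * e2
        refine (mul_eq_zero.1 e).resolve_right (ne_of_lt ?_)
        have := mul_neg_of_neg_of_pos c1 c4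
        have := mul_pos c3 c2
        linarith
      subst hs
      refine ⟨rfl, ?_⟩
      rw [zero_mul, zero_add] at e2
      exact (mul_eq_zero.1 e2).resolve_right c4.ne'
    rw [Units.IsMaxRank, ← linearIndependent_equiv (finCongr hr.symm)]
    convert this using 1
    ext i : 1
    fin_cases i <;> rfl
  have hfin := Units.isMaxRank_iff_closure_finiteIndex.1 hmax
  refine Subgroup.finiteIndex_of_le (H := Subgroup.closure (Set.range u)) ?_
  refine Subgroup.closure_mono ?_
  rintro _ ⟨i, rfl⟩
  simp only [hu, Function.comp_apply]
  generalize Fin.cast hr i = j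
  fin_cases j <;> simp

/-- If a prime `p` divides the unit index, then some element of `⟨ε_l, ε_l - 1⟩` which is not a
`p`-th power there is, up to sign, the `p`-th power of a unit. -/
theorem IsLocatedRoots.exists_hasExponents (h : IsLocatedRoots l θ) (hl : 3 ≤ l) {p : ℕ}
    (hp : p.Prime) (hdvd : p ∣ unitIndex l) :
    ∃ (u : (𝓞 (EnnolaField l))ˣ) (n : Fin 3 → ℤ), HasExponents p u n ∧ ∃ i, ¬ (p : ℤ) ∣ n i := by
  have := h.finiteIndex hl
  have : Fact p.Prime := ⟨hp⟩
  have hdvd' : p ∣ Nat.card ((𝓞 (EnnolaField l))ˣ ⧸ ennolaSubgroup l) := hdvd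
  obtain ⟨x, hx⟩ := exists_prime_orderOf_dvd_card' p hdvd'
  obtain ⟨η, rfl⟩ := QuotientGroup.mk_surjective x
  have hηp : η ^ p ∈ ennolaSubgroup l := by
    rw [← QuotientGroup.eq_one_iff, QuotientGroup.mk_pow, ← hx, pow_orderOf_eq_one]
  have hη : η ∉ ennolaSubgroup l := by
    intro hmem
    rw [(QuotientGroup.eq_one_iff η).2 hmem, orderOf_one] at hx
    exact hp.one_lt.ne hx
  obtain ⟨a, b, hab⟩ := exists_of_mem_ennolaSubgroup hηp
  refine ⟨η, ![-a, -b, a + b], ⟨by simp; ring, by simpa using hab⟩, ?_⟩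
  by_contra! hcon
  have ha : (p : ℤ) ∣ a := by simpa using hcon 0
  have hb : (p : ℤ) ∣ b := by simpa using hcon 1
  obtain ⟨a, rfl⟩ := ha
  obtain ⟨b, rfl⟩ := hb
  apply hη
  set v := ennolaUnit l ^ a * ennolaUnitSubOne l ^ b with hv
  have hvp : ennolaUnit l ^ (p * a) * ennolaUnitSubOne l ^ (p * b) = v ^ p := by
    rw [hv, mul_pow, ← zpow_natCast, ← zpow_natCast, ← zpow_mul, ← zpow_mul, mul_comm a,
      mul_comm b]
  rw [hvp] at hab
  -- The factor `2` absorbs the undetermined sign.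
  have h1 : (η * v⁻¹) ^ (p * 2) = 1 := by
    rw [pow_mul, mul_pow, inv_pow]
    rcases hab with hab | hab <;> rw [hab] <;> simp
  have h2 := mem_ennolaSubgroup_of_pow_eq_one (by have := hp.pos; omega) h1
  have h3 := mul_mem h2 (zpow_mul_zpow_mem_ennolaSubgroup l a b)
  rwa [← hv, inv_mul_cancel_right] at h3

end Index

/-! ### Realising prescribed exponent vectors -/

theorem sum_fin_three_of_ne {M : Type*} [AddCommMonoid M] {i j k : Fin 3} (hij : i ≠ j)
    (hik : i ≠ k) (hjk : j ≠ k) (f : Fin 3 → M) : ∑ x, f x = f i + f j + f k := by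
  have : (Finset.univ : Finset (Fin 3)) = {i, j, k} := by
    revert i j k; decide
  rw [this, Finset.sum_insert (by simp [hij, hik]), Finset.sum_insert (by simp [hjk]),
    Finset.sum_singleton, add_assoc]

theorem eq_or_eq_or_eq_of_ne {i j k : Fin 3} (hij : i ≠ j) (hik : i ≠ k) (hjk : j ≠ k)
    (x : Fin 3) : x = i ∨ x = j ∨ x = k := by
  revert i j k x; decide

theorem exists_third (i j : Fin 3) (hij : i ≠ j) : ∃ k, i ≠ k ∧ j ≠ k := by
  revert i j; decide

section Realisation

variable {l p : ℕ} {θ : Fin 3 → ℝ} {τ : ℝ} {u : (𝓞 (EnnolaField l))ˣ} {n : Fin 3 → ℤ}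

theorem HasExponents.exists_of_eq_mul (hu : HasExponents p u n) (κ : ZMod p) {m : Fin 3 → ℤ}
    (hm : ∑ i, m i = 0) (heq : ∀ i, (m i : ZMod p) = κ * (n i : ZMod p)) :
    ∃ v : (𝓞 (EnnolaField l))ˣ, HasExponents p v m := by
  obtain ⟨k, rfl⟩ := ZMod.intCast_surjective κ
  rw [Fin.sum_univ_three] at hm
  refine hu.exists_of_dvd k hm fun i => ?_
  rw [← CharP.intCast_eq_zero_iff (ZMod p) p]
  push_cast
  rw [heq i, sub_self]

/-- The same, for exponents `a`, `b`, `c` at the places `i`, `j`, `k`. -/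
theorem HasExponents.exists_of_eq_mul_three (hu : HasExponents p u n) (κ : ZMod p)
    {i j k : Fin 3} (hij : i ≠ j) (hik : i ≠ k) (hjk : j ≠ k) {a b c : ℤ} (habc : a + b + c = 0)
    (ha : (a : ZMod p) = κ * (n i : ZMod p)) (hb : (b : ZMod p) = κ * (n j : ZMod p))
    (hc : (c : ZMod p) = κ * (n k : ZMod p)) :
    ∃ (v : (𝓞 (EnnolaField l))ˣ) (m : Fin 3 → ℤ), HasExponents p v m ∧
      m i = a ∧ m j = b ∧ m k = c := by
  set m : Fin 3 → ℤ := fun x => if x = i then a else if x = j then b else c with hm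
  have h1 : m i = a := by simp [hm]
  have h2 : m j = b := by simp [hm, hij.symm]
  have h3 : m k = c := by simp [hm, hik.symm, hjk.symm]
  have hall := eq_or_eq_or_eq_of_ne hij hik hjk
  obtain ⟨v, hv⟩ := hu.exists_of_eq_mul κ (m := m)
    (by rw [sum_fin_three_of_ne hij hik hjk, h1, h2, h3, habc]) (fun x => by
      rcases hall x with rfl | rfl | rfl
      · rw [h1, ha]
      · rw [h2, hb]
      · rw [h3, hc])
  exact ⟨v, m, hv, h1, h2, h3⟩

theorem IsEnnolaRoots.exists_int_eq_add (h : IsEnnolaRoots l θ) (x : (𝓞 (EnnolaField l))ˣ)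
    {i j k : Fin 3} (hij : i ≠ j) (hik : i ≠ k) (hjk : j ≠ k) :
    ∃ t : ℤ, (t : ℝ) = h.emb i (x : EnnolaField l) + h.emb j (x : EnnolaField l) +
      h.emb k (x : EnnolaField l) := by
  obtain ⟨t, ht⟩ := h.exists_int_eq_sum (x : 𝓞 (EnnolaField l))
  refine ⟨t, ?_⟩
  rw [ht, sum_fin_three_of_ne hij hik hjk]

theorem abs_le_of_three {i j k : Fin 3} (hij : i ≠ j) (hik : i ≠ k) (hjk : j ≠ k)
    {m : Fin 3 → ℤ} {b : ℤ} (hi : |m i| ≤ b) (hj : |m j| ≤ b) (hk : |m k| ≤ b) :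
    ∀ x, |m x| ≤ b := by
  have hall := eq_or_eq_or_eq_of_ne hij hik hjk
  intro x
  rcases hall x with rfl | rfl | rfl <;> assumption

end Realisation

/-! ### Zero residues, equal residues, and the primes `2` and `3` -/

section Cases

variable {l p : ℕ} {θ : Fin 3 → ℝ} {τ : ℝ} {u : (𝓞 (EnnolaField l))ˣ} {n : Fin 3 → ℤ}

theorem HasExponents.false_of_zero [Fact p.Prime] (hu : HasExponents p u n)
    (h : IsLocatedRoots l θ) (hs : IsScale l p τ) (hp : 3 ≤ p) {i j k : Fin 3} (hij : i ≠ j)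
    (hik : i ≠ k) (hjk : j ≠ k) (hi : (n i : ZMod p) = 0) (hj : (n j : ZMod p) ≠ 0) : False := by
  have hsum : (n i : ZMod p) + n j + n k = 0 := by
    have := hu.1
    rw [← Fin.sum_univ_three, sum_fin_three_of_ne hij hik hjk] at this
    exact_mod_cast congrArg (Int.cast : ℤ → ZMod p) this
  have hk : (n k : ZMod p) = -n j := by linear_combination hsum - hi
  obtain ⟨v, m, hv, m1, m2, m3⟩ := hu.exists_of_eq_mul_three (-(n j : ZMod p)⁻¹) hij hik hjk
    (a := p) (b := -1) (c := 1 - p) (by ring) (by rw [hi]; simp) (by simp [hj])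
    (by rw [hk]; simp [hj])
  have hm : ∀ x, |m x| ≤ p := abs_le_of_three hij hik hjk (by rw [m1]; simp)
    (by rw [m2]; simp; omega) (by rw [m3, abs_le]; omega)
  have hsz := hv.hasSize h hs hm
  obtain ⟨t, ht⟩ := (h.isEnnolaRoots hs.three_le).exists_int_eq_add v hij hik hjk
  exact intCast_ne_of_exponents_p hs hp (m1 ▸ hsz i) (m2 ▸ hsz j) (m3 ▸ hsz k) t ht

theorem HasExponents.false_of_double {m : ℤ} (hm0 : 0 < m) (hmp : 3 * m < 2 * p)
    (hm4 : 2 * m ≤ p) (hu : HasExponents p u n) (h : IsLocatedRoots l θ) (hs : IsScale l p τ)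
    {i j k : Fin 3} (hij : i ≠ j) (hik : i ≠ k) (hjk : j ≠ k) (hi : n i = m) (hj : n j = m)
    (hk : n k = -2 * m)
    (hpos : 0 < (h.isEnnolaRoots hs.three_le).emb i (u : EnnolaField l) *
      (h.isEnnolaRoots hs.three_le).emb j (u : EnnolaField l)) : False := by
  have hm : ∀ x, |n x| ≤ p := abs_le_of_three hij hik hjk (by rw [hi, abs_le]; omega)
    (by rw [hj, abs_le]; omega) (by rw [hk, abs_le]; omega)
  have hsz := hu.hasSize h hs hm
  obtain ⟨t, ht⟩ := (h.isEnnolaRoots hs.three_le).exists_int_eq_add u hij hik hjk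
  obtain ⟨t₂, ht₂⟩ := (h.isEnnolaRoots hs.three_le).exists_int_eq_add (u ^ 2) hij hik hjk
  simp only [Units.coe_pow, map_pow] at ht₂
  exact false_of_exponents_double hs hm0 hmp (hi ▸ hsz i) (hj ▸ hsz j) (hk ▸ hsz k) hpos ht ht₂

/-- The residues are proportional to `(1, 1, -2)`. Squaring the corresponding unit makes all
conjugates positive, at the cost of exponents `(2, 2, -4)`, which stay within `p` because `p ≥ 5`.
-/
theorem HasExponents.false_of_eq [Fact p.Prime] (hu : HasExponents p u n)
    (h : IsLocatedRoots l θ) (hs : IsScale l p τ) (hp : 5 ≤ p) {i j k : Fin 3} (hij : i ≠ j)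
    (hik : i ≠ k) (hjk : j ≠ k) (heq : (n i : ZMod p) = n j) (hi : (n i : ZMod p) ≠ 0) :
    False := by
  have hsum : (n i : ZMod p) + n j + n k = 0 := by
    have := hu.1
    rw [← Fin.sum_univ_three, sum_fin_three_of_ne hij hik hjk] at this
    exact_mod_cast congrArg (Int.cast : ℤ → ZMod p) this
  have hk : (n k : ZMod p) = -2 * n i := by linear_combination hsum + heq
  obtain ⟨v, m, hv, m1, m2, m3⟩ := hu.exists_of_eq_mul_three (n i : ZMod p)⁻¹ hij hik hjk
    (a := 1) (b := 1) (c := -2) (by ring) (by simp [hi]) (by rw [← heq]; simp [hi])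
    (by rw [hk]; push_cast; field_simp)
  have hpos : ∀ x, 0 < (h.isEnnolaRoots hs.three_le).emb x ((v ^ 2 : (𝓞 (EnnolaField l))ˣ) :
      EnnolaField l) := by
    intro x
    rw [Units.coe_pow, map_pow]
    have := (h.isEnnolaRoots hs.three_le).emb_unit_ne_zero x v
    positivity
  exact hv.sq.false_of_double (m := 2) (by norm_num) (by omega) (by omega) h hs hij hik hjk
    (by simp [m1]) (by simp [m2]) (by simp [m3]) (mul_pos (hpos i) (hpos j))

theorem IsLocatedRoots.sign_facts (h : IsLocatedRoots l θ) (hl : 3 ≤ l) :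
    θ 0 < 0 ∧ 1 < θ 1 := by
  have hl' : (3 : ℝ) ≤ l := by exact_mod_cast hl
  have a := h.upper_zero
  have b := h.lower_one
  have e1 : 0 < 1 / ((l : ℝ) + 1) := by positivity
  have e2 : 0 < 1 / ((l : ℝ) + 3) := by positivity
  constructor <;> linarith

theorem HasExponents.emb_pow (hu : HasExponents p u n) (h : IsEnnolaRoots l θ) :
    ∃ s : ℤ, |s| = 1 ∧ ∀ i, h.emb i (u : EnnolaField l) ^ p =
      s * (θ i ^ (-n 0) * (θ i - 1) ^ (-n 1)) := by
  rcases hu.2 with hu | hu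
  · refine ⟨1, by simp, fun i => ?_⟩
    rw [← map_pow, ← Units.coe_pow, hu, h.emb_zpow_mul_zpow, Int.cast_one, one_mul]
  · refine ⟨-1, by simp, fun i => ?_⟩
    have e : h.emb i (-1) = -1 := by rw [map_neg, map_one]
    rw [← map_pow, ← Units.coe_pow, hu, ← neg_one_mul, Units.coe_mul, map_mul,
      h.emb_zpow_mul_zpow, Units.coe_neg_one, map_neg, map_one, e, Int.cast_neg,
      Int.cast_one]

/-- Three nonzero residues mod `3` with sum zero coincide. Squaring would make the exponents exceed
`p`, so the signs are read off instead: the cube of the product of the first two conjugates is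
positive. -/
theorem HasExponents.false_of_three (hu : HasExponents 3 u n)
    (h : IsLocatedRoots l θ) (hs : IsScale l 3 τ) (h0 : (n 0 : ZMod 3) ≠ 0)
    (h1 : (n 1 : ZMod 3) ≠ 0) (h2 : (n 2 : ZMod 3) ≠ 0) : False := by
  have hsum : (n 0 : ZMod 3) + n 1 + n 2 = 0 := by
    exact_mod_cast congrArg (Int.cast : ℤ → ZMod 3) hu.1
  have key : ∀ a b c : ZMod 3, a ≠ 0 → b ≠ 0 → c ≠ 0 → a + b + c = 0 →
      1 = a * a ∧ 1 = a * b ∧ -2 = a * c := by decide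
  obtain ⟨k0, k1, k2⟩ := key _ _ _ h0 h1 h2 hsum
  obtain ⟨v, m, hv, m1, m2, m3⟩ := hu.exists_of_eq_mul_three (n 0 : ZMod 3)
    (i := 0) (j := 1) (k := 2) (by decide) (by decide) (by decide)
    (a := 1) (b := 1) (c := -2) (by ring) (by push_cast; exact k0) (by push_cast; exact k1)
    (by push_cast; exact k2)
  obtain ⟨s, hs1, hpow⟩ := hv.emb_pow (h.isEnnolaRoots hs.three_le)
  obtain ⟨a, b⟩ := h.sign_facts hs.three_le
  refine hv.false_of_double (m := 1) (by norm_num) (by norm_num) (by norm_num) h hs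
    (by decide) (by decide) (by decide) m1 m2 m3 ?_
  refine (Odd.pow_pos_iff (n := 3) (by decide)).1 ?_
  rw [mul_pow, hpow, hpow, m1, m2, mul_mul_mul_comm, sq_sign hs1, one_mul]
  refine mul_pos (mul_pos_of_neg_of_neg (zpow_neg_one (θ 0) ▸ inv_neg''.2 a)
    (zpow_neg_one (θ 0 - 1) ▸ inv_neg''.2 (by linarith))) (mul_pos ?_ ?_)
  · exact zpow_pos (by linarith) _
  · exact zpow_pos (by linarith) _

/-- For `(1, 0, -1)` and `(0, 1, -1)` a product of two squares would equal a product of conjugates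
of `ε` or `ε - 1`, inverted, at places `0` and `1`, where the signs are opposite. For `(1, 1, -2)`
either sign of the product of the first two conjugates is contradictory. -/
theorem HasExponents.false_of_two (hu : HasExponents 2 u n)
    (h : IsLocatedRoots l θ) (hs : IsScale l 2 τ) (hn : ∃ i, (n i : ZMod 2) ≠ 0) : False := by
  have hsum : (n 0 : ZMod 2) + n 1 + n 2 = 0 := by
    exact_mod_cast congrArg (Int.cast : ℤ → ZMod 2) hu.1
  have H := h.isEnnolaRoots hs.three_le
  obtain ⟨a, b⟩ := h.sign_facts hs.three_le
  have key : ∀ a b c : ZMod 2, a + b + c = 0 → (a ≠ 0 ∨ b ≠ 0 ∨ c ≠ 0) →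
      (1 = 1 * a ∧ 0 = 1 * b ∧ -1 = 1 * c) ∨ (0 = 1 * a ∧ 1 = 1 * b ∧ -1 = 1 * c) ∨
      (1 = 1 * a ∧ 1 = 1 * b ∧ -2 = 1 * c) := by decide
  have hsq : ∀ (v : (𝓞 (EnnolaField l))ˣ) (i : Fin 3), 0 < H.emb i (v : EnnolaField l) ^ 2 := by
    intro v i
    have := H.emb_unit_ne_zero i v
    positivity
  have hn' : (n 0 : ZMod 2) ≠ 0 ∨ (n 1 : ZMod 2) ≠ 0 ∨ (n 2 : ZMod 2) ≠ 0 := by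
    obtain ⟨i, hi⟩ := hn
    fin_cases i
    · exact Or.inl hi
    · exact Or.inr (Or.inl hi)
    · exact Or.inr (Or.inr hi)
  rcases key _ _ _ hsum hn' with ⟨k0, k1, k2⟩ | ⟨k0, k1, k2⟩ | ⟨k0, k1, k2⟩
  · obtain ⟨v, m, hv, m1, m2, m3⟩ := hu.exists_of_eq_mul_three (1 : ZMod 2)
      (i := 0) (j := 1) (k := 2) (by decide) (by decide) (by decide)
      (a := 1) (b := 0) (c := -1) (by ring) (by push_cast; exact k0) (by push_cast; exact k1)
      (by push_cast; exact k2)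
    obtain ⟨s, hs1, hpow⟩ := hv.emb_pow H
    have p0 := mul_pos (hsq v 0) (hsq v 1)
    rw [hpow, hpow, m1, m2, mul_mul_mul_comm, sq_sign hs1, one_mul, neg_zero, zpow_zero,
      zpow_zero, mul_one, mul_one, zpow_neg_one, zpow_neg_one] at p0
    have := mul_neg_of_neg_of_pos (inv_neg''.2 a) (inv_pos.2 (by linarith : 0 < θ 1))
    linarith
  · obtain ⟨v, m, hv, m1, m2, m3⟩ := hu.exists_of_eq_mul_three (1 : ZMod 2)
      (i := 0) (j := 1) (k := 2) (by decide) (by decide) (by decide)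
      (a := 0) (b := 1) (c := -1) (by ring) (by push_cast; exact k0) (by push_cast; exact k1)
      (by push_cast; exact k2)
    obtain ⟨s, hs1, hpow⟩ := hv.emb_pow H
    have p0 := mul_pos (hsq v 0) (hsq v 1)
    rw [hpow, hpow, m1, m2, mul_mul_mul_comm, sq_sign hs1, one_mul, neg_zero, zpow_zero,
      zpow_zero, one_mul, one_mul, zpow_neg_one, zpow_neg_one] at p0
    have := mul_neg_of_neg_of_pos (inv_neg''.2 (by linarith : θ 0 - 1 < 0))
      (inv_pos.2 (by linarith : 0 < θ 1 - 1))
    linarith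
  · obtain ⟨v, m, hv, m1, m2, m3⟩ := hu.exists_of_eq_mul_three (1 : ZMod 2)
      (i := 0) (j := 1) (k := 2) (by decide) (by decide) (by decide)
      (a := 1) (b := 1) (c := -2) (by ring) (by push_cast; exact k0) (by push_cast; exact k1)
      (by push_cast; exact k2)
    rcases lt_trichotomy (H.emb 0 (v : EnnolaField l) * H.emb 1 (v : EnnolaField l)) 0 with
      hlt | heq | hgt
    · have hm : ∀ x, |m x| ≤ (2 : ℕ) := abs_le_of_three (i := 0) (j := 1) (k := 2) (by decide)
        (by decide) (by decide) (by rw [m1]; norm_num) (by rw [m2]; norm_num)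
        (by rw [m3]; norm_num)
      have hsz := hv.hasSize h hs hm
      obtain ⟨t, ht⟩ := H.exists_int_eq_add v (i := 0) (j := 1) (k := 2) (by decide)
        (by decide) (by decide)
      have c0 : coeffExponents m 0 = 0 := by
        simp [coeffExponents, coeffRoot, coeffSubOne, m1, m2]
      have c1 : coeffExponents m 1 = 1 := by
        simp [coeffExponents, coeffRoot, coeffSubOne, m1, m2]
      have s0 := hsz 0
      have s1 := hsz 1
      rw [c0, m1] at s0
      rw [c1, m2] at s1
      exact intCast_ne_of_exponents_two hs s0 s1 (m3 ▸ hsz 2) hlt t ht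
    · exact mul_ne_zero (H.emb_unit_ne_zero 0 v) (H.emb_unit_ne_zero 1 v) heq
    · exact hv.false_of_double (m := 1) (by norm_num) (by norm_num) (by norm_num) h hs
        (by decide) (by decide) (by decide) m1 m2 m3 hgt

end Cases

/-! ### Residue sums and the pigeonhole argument -/

section ResidueSums

variable {p : ℕ} [Fact p.Prime] {r : Fin 3 → ZMod p}

/-- The sum of the residues in `[0, p)` of the entries of `κ • r`. -/
def residueSum (r : Fin 3 → ZMod p) (κ : ZMod p) : ℕ := ∑ i, (κ * r i).val

/-- The sum is a multiple of `p`, and its three terms lie strictly between `0` and `p`. -/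
theorem residueSum_eq (hr : ∀ i, r i ≠ 0) (hsum : ∑ i, r i = 0) {κ : ZMod p} (hκ : κ ≠ 0) :
    residueSum r κ = p ∨ residueSum r κ = 2 * p := by
  have hdvd : p ∣ residueSum r κ := by
    rw [← ZMod.natCast_eq_zero_iff, residueSum]
    push_cast
    simp only [ZMod.natCast_val, ZMod.cast_id', id_eq]
    rw [← Finset.mul_sum, hsum, mul_zero]
  have hpos : ∀ i, 0 < (κ * r i).val := fun i =>
    Nat.pos_of_ne_zero ((ZMod.val_ne_zero _).2 (mul_ne_zero hκ (hr i)))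
  have hlt : ∀ i, (κ * r i).val < p := fun i => ZMod.val_lt _
  obtain ⟨c, hc⟩ := hdvd
  have h1 : 0 < p * c ∧ p * c < p * 3 := by
    rw [← hc, residueSum, Fin.sum_univ_three]
    have := hpos 0; have := hlt 0; have := hlt 1; have := hlt 2
    omega
  have h2 : c < 3 := Nat.lt_of_mul_lt_mul_left h1.2
  have h3 : c ≠ 0 := by rintro rfl; simp at h1
  rcases (by omega : c = 1 ∨ c = 2) with rfl | rfl
  · left; rw [hc, mul_one]
  · right; rw [hc, mul_comm]

theorem residueSum_neg (hr : ∀ i, r i ≠ 0) {κ : ZMod p} (hκ : κ ≠ 0) :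
    residueSum r (-κ) + residueSum r κ = 3 * p := by
  have hval : ∀ i, (-κ * r i).val + (κ * r i).val = p := by
    intro i
    have : NeZero (κ * r i) := ⟨mul_ne_zero hκ (hr i)⟩
    rw [neg_mul, ZMod.val_neg_of_ne_zero]
    have := ZMod.val_lt (κ * r i)
    omega
  rw [residueSum, residueSum, ← Finset.sum_add_distrib, Finset.sum_congr rfl fun i _ => hval i]
  simp

/-- Among the three cyclic quotients of the entries of `r` there is one that preserves the
residue sum of some multiple of `r`. -/
theorem exists_residueSum_eq (hr : ∀ i, r i ≠ 0) (hsum : ∑ i, r i = 0) :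
    ∃ i : Fin 3, ∃ κ κ' : ZMod p, κ ≠ 0 ∧ κ' * r i = κ * r (i + 1) ∧
      residueSum r κ = 2 * p ∧ residueSum r κ' = 2 * p := by
  have hp : 0 < p := (Fact.out : p.Prime).pos
  have step : ∀ (i : Fin 3) (κ κ' : ZMod p), κ ≠ 0 → κ' ≠ 0 → κ' * r i = κ * r (i + 1) →
      residueSum r κ = residueSum r κ' → ∃ i : Fin 3, ∃ κ κ' : ZMod p, κ ≠ 0 ∧
      κ' * r i = κ * r (i + 1) ∧ residueSum r κ = 2 * p ∧ residueSum r κ' = 2 * p := by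
    intro i κ κ' hκ hκ' heq hres
    rcases residueSum_eq hr hsum hκ with h1 | h1
    · refine ⟨i, -κ, -κ', neg_ne_zero.2 hκ, by rw [neg_mul, neg_mul, heq], ?_, ?_⟩
      · have := residueSum_neg hr hκ; omega
      · have := residueSum_neg hr hκ'; omega
    · exact ⟨i, κ, κ', hκ, heq, h1, by omega⟩
  have h0 := hr 0
  have h1 := hr 1
  have h2 := hr 2
  have a0 := residueSum_eq hr hsum h0
  have a1 := residueSum_eq hr hsum h1
  have a2 := residueSum_eq hr hsum h2
  by_cases e0 : residueSum r (r 0) = residueSum r (r 1)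
  · exact step 0 _ _ h0 h1 (mul_comm _ _) e0
  by_cases e1 : residueSum r (r 1) = residueSum r (r 2)
  · exact step 1 _ _ h1 h2 (mul_comm _ _) e1
  -- Three sums take only two values, and any two of the three indices are cyclically adjacent.
  have e2 : residueSum r (r 2) = residueSum r (r 0) := by omega
  exact step 2 _ _ h2 h0 (mul_comm _ _) e2

end ResidueSums

/-! ### Pairwise distinct nonzero residues -/

theorem injective_five {α : Type*} {a b c d e : α} (hab : a ≠ b) (hac : a ≠ c) (had : a ≠ d)
    (hae : a ≠ e) (hbc : b ≠ c) (hbd : b ≠ d) (hbe : b ≠ e) (hcd : c ≠ d) (hce : c ≠ e)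
    (hde : d ≠ e) : Function.Injective ![a, b, c, d, e] := by
  intro i j
  fin_cases i <;> fin_cases j <;>
    simp [hab, hac, had, hae, hbc, hbd, hbe, hcd, hce, hde, hab.symm, hac.symm, had.symm,
      hae.symm, hbc.symm, hbd.symm, hbe.symm, hcd.symm, hce.symm, hde.symm]

/-- Since `κ' a = κ b`, a coincidence `κ x = κ' y` means `x a = b y`. After eliminating `c` this
forces two of `a`, `b`, `c` to agree, or one to vanish, or `a² + a b + b² = 0`. -/
theorem injective_of_sum_eq_zero {F : Type*} [Field F] {a b c κ κ' : F} (hb : b ≠ 0)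
    (hc : c ≠ 0) (hab : a ≠ b) (hac : a ≠ c) (hbc : b ≠ c) (hsum : a + b + c = 0)
    (hq : a ^ 2 + a * b + b ^ 2 ≠ 0) (hκ : κ ≠ 0) (hκ' : κ' * a = κ * b) :
    Function.Injective ![κ * b, κ * a, κ * c, κ' * b, κ' * c] := by
  have hκ0 : κ' ≠ 0 := by
    rintro rfl
    exact mul_ne_zero hκ hb (by rw [← hκ', zero_mul])
  have hc' : c = -a - b := by linear_combination hsum
  have hsq : ∀ x y : F, κ * x = κ' * y → x * a = b * y := fun x y hxy =>
    mul_left_cancel₀ hκ (by linear_combination a * hxy + y * hκ')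
  refine injective_five ?_ ?_ ?_ ?_ ?_ ?_ ?_ ?_ ?_ ?_
  · exact fun h => hab (mul_left_cancel₀ hκ h).symm
  · exact fun h => hbc (mul_left_cancel₀ hκ h)
  · exact fun h => hab (mul_left_cancel₀ hb (hsq _ _ h))
  · exact fun h => hac (mul_left_cancel₀ hb (hsq _ _ h))
  · exact fun h => hac (mul_left_cancel₀ hκ h)
  · intro h
    have h1 := hsq _ _ h
    have : (a - b) * c = 0 := by rw [hc']; linear_combination -h1
    exact (mul_ne_zero (sub_ne_zero.2 hab) hc) this
  · intro h
    have h1 := hsq _ _ h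
    rw [hc'] at h1
    exact hq (by linear_combination h1)
  · intro h
    have h1 := hsq _ _ h
    rw [hc'] at h1
    exact hq (by linear_combination -h1)
  · intro h
    have h1 := hsq _ _ h
    exact hab (mul_right_cancel₀ hc (by linear_combination h1))
  · exact fun h => hbc (mul_left_cancel₀ hκ0 h)

section Generic

variable {l p : ℕ} {θ : Fin 3 → ℝ} {τ : ℝ} {u : (𝓞 (EnnolaField l))ˣ} {n : Fin 3 → ℤ}

/-- The exponents of this unit are positive at one place and negative at the two others. -/
theorem HasExponents.exists_of_residueSum [Fact p.Prime] (hu : HasExponents p u n)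
    {κ : ZMod p} (hκ : residueSum (fun i => (n i : ZMod p)) κ = 2 * p)
    {i j k : Fin 3} (hij : i ≠ j) (hik : i ≠ k) (hjk : j ≠ k) :
    ∃ (v : (𝓞 (EnnolaField l))ˣ) (m : Fin 3 → ℤ), HasExponents p v m ∧ (∀ x, |m x| ≤ p) ∧
      m i = (κ * (n i : ZMod p)).val ∧ m j = (κ * (n j : ZMod p)).val - p ∧
      m k = (κ * (n k : ZMod p)).val - p := by
  have hs : (κ * (n i : ZMod p)).val + (κ * (n j : ZMod p)).val + (κ * (n k : ZMod p)).val =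
      2 * p := by
    rw [← hκ, residueSum, sum_fin_three_of_ne hij hik hjk]
  obtain ⟨v, m, hv, m1, m2, m3⟩ := hu.exists_of_eq_mul_three κ hij hik hjk
    (a := (κ * (n i : ZMod p)).val) (b := (κ * (n j : ZMod p)).val - p)
    (c := (κ * (n k : ZMod p)).val - p) (by omega) (by simp) (by simp) (by simp)
  have a1 := ZMod.val_lt (κ * (n i : ZMod p))
  have a2 := ZMod.val_lt (κ * (n j : ZMod p))
  have a3 := ZMod.val_lt (κ * (n k : ZMod p))
  exact ⟨v, m, hv, abs_le_of_three hij hik hjk (by rw [m1, abs_le]; omega)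
    (by rw [m2, abs_le]; omega) (by rw [m3, abs_le]; omega), m1, m2, m3⟩

theorem val_sub_injective (p : ℕ) [NeZero p] :
    Function.Injective fun a : ZMod p => (a.val : ℤ) - p := fun _ _ hab =>
  ZMod.val_injective p (Int.ofNat_inj.1 (sub_left_injective hab))

/-- The units attached to `κ` and `κ'` have the same positive exponent, at place `j` and at place
`i` respectively. Residue sum `2 p` allows exactly two residues to be lowered by `p`, which makes
all other exponents negative. -/
theorem HasExponents.false_of_generic [Fact p.Prime] (hu : HasExponents p u n)
    (h : IsLocatedRoots l θ) (hs : IsScale l p τ) {κ κ' : ZMod p} {i j k : Fin 3} (hij : i ≠ j)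
    (hik : i ≠ k) (hjk : j ≠ k) (hi0 : (n i : ZMod p) ≠ 0) (hj0 : (n j : ZMod p) ≠ 0)
    (hk0 : (n k : ZMod p) ≠ 0) (hij0 : (n i : ZMod p) ≠ n j) (hik0 : (n i : ZMod p) ≠ n k)
    (hjk0 : (n j : ZMod p) ≠ n k)
    (hq : (n i : ZMod p) ^ 2 + n i * n j + (n j : ZMod p) ^ 2 ≠ 0) (hκ : κ ≠ 0)
    (heq : κ' * (n i : ZMod p) = κ * n j)
    (h1 : residueSum (fun i => (n i : ZMod p)) κ = 2 * p)
    (h2 : residueSum (fun i => (n i : ZMod p)) κ' = 2 * p) : False := by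
  have hsum : (n i : ZMod p) + n j + n k = 0 := by
    have := hu.1
    rw [← Fin.sum_univ_three, sum_fin_three_of_ne hij hik hjk] at this
    exact_mod_cast congrArg (Int.cast : ℤ → ZMod p) this
  obtain ⟨v, m, hv, hm, m1, m2, m3⟩ := hu.exists_of_residueSum h1 hij.symm hjk hik
  obtain ⟨w, m', hw, hm', m1', m2', m3'⟩ := hu.exists_of_residueSum h2 hij hik hjk
  have hsz := hv.hasSize h hs hm
  have hsz' := hw.hasSize h hs hm'
  obtain ⟨t, ht⟩ := (h.isEnnolaRoots hs.three_le).exists_int_eq_add v hij.symm hjk hik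
  obtain ⟨t', ht'⟩ := (h.isEnnolaRoots hs.three_le).exists_int_eq_add w hij hik hjk
  rw [heq, ← m1] at m1'
  have hlt : ∀ a : ZMod p, ((a.val : ℤ)) < p := fun a => by exact_mod_cast ZMod.val_lt a
  have hpos : 0 < ((κ * (n i : ZMod p)).val : ℤ) := by
    exact_mod_cast Nat.pos_of_ne_zero ((ZMod.val_ne_zero _).2 (mul_ne_zero hκ hi0))
  have hinj := (val_sub_injective p).comp
    (injective_of_sum_eq_zero hj0 hk0 hij0 hik0 hjk0 hsum hq hκ heq)
  have e : (fun a : ZMod p => (a.val : ℤ) - p) ∘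
      ![κ * (n j : ZMod p), κ * n i, κ * n k, κ' * n j, κ' * n k] =
      ![m j - p, m i, m k, m' j, m' k] := by
    rw [m1, m2, m3, m2', m3']
    funext x
    fin_cases x <;> rfl
  rw [e] at hinj
  have a1 := hlt (κ * (n i : ZMod p))
  have a2 := hlt (κ * (n j : ZMod p))
  have a3 := hlt (κ * (n k : ZMod p))
  have a4 := hlt (κ' * (n j : ZMod p))
  have a5 := hlt (κ' * (n k : ZMod p))
  exact false_of_exponents_distinct hs (by omega) (by omega) (by omega) (by omega) (by omega)
    (by omega) hinj (hsz j) (hsz i) (hsz k) (m1' ▸ hsz' i) (hsz' j) (hsz' k) ht ht'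

theorem HasExponents.false_of_cyclic [Fact p.Prime] (hu : HasExponents p u n)
    (h : IsLocatedRoots l θ) (hs : IsScale l p τ) {κ : ZMod p} (h00 : (n 0 : ZMod p) ≠ 0)
    (h10 : (n 1 : ZMod p) ≠ 0) (h01 : (n 0 : ZMod p) ≠ n 1)
    (h02 : (n 0 : ZMod p) ≠ n 2) (h12 : (n 1 : ZMod p) ≠ n 2)
    (hq : (n 0 : ZMod p) ^ 2 + n 0 * n 1 + (n 1 : ZMod p) ^ 2 = 0) (hκ : κ ≠ 0)
    (h1 : residueSum (fun i => (n i : ZMod p)) κ = 2 * p) : False := by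
  have hsum : (n 0 : ZMod p) + n 1 + n 2 = 0 := by
    exact_mod_cast congrArg (Int.cast : ℤ → ZMod p) hu.1
  have h2 : (n 2 : ZMod p) = -n 0 - n 1 := by linear_combination hsum
  obtain ⟨κ', hκ'⟩ : ∃ κ', κ' = κ * n 1 * (n 0 : ZMod p)⁻¹ := ⟨_, rfl⟩
  have q0 : κ' * (n 0 : ZMod p) = κ * n 1 := by rw [hκ']; field_simp
  -- The quadratic relation makes multiplication by `n 1 / n 0` a cyclic permutation of the
  -- residues, so `κ'` automatically has the same residue sum as `κ`.
  have q1 : κ' * (n 1 : ZMod p) = κ * n 2 := by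
    apply mul_right_cancel₀ h00
    rw [h2]
    linear_combination (n 1 : ZMod p) * q0 + κ * hq
  have q2 : κ' * (n 2 : ZMod p) = κ * n 0 := by
    rw [h2] at q1 ⊢
    linear_combination -q0 - q1
  have hres : residueSum (fun i => (n i : ZMod p)) κ' = 2 * p := by
    rw [← h1, residueSum, residueSum, Fin.sum_univ_three, Fin.sum_univ_three, q0, q1, q2]
    ring
  obtain ⟨v, m, hv, hm, m1, m2, m3⟩ := hu.exists_of_residueSum (i := 1) (j := 0) (k := 2) h1
    (by decide) (by decide) (by decide)
  obtain ⟨w, m', hw, hm', m1', m2', m3'⟩ := hu.exists_of_residueSum (i := 0) (j := 2) (k := 1)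
    hres (by decide) (by decide) (by decide)
  rw [q0] at m1'
  rw [q2] at m2'
  rw [q1] at m3'
  have hsz := hv.hasSize h hs hm
  have hsz' := hw.hasSize h hs hm'
  obtain ⟨t, ht⟩ := (h.isEnnolaRoots hs.three_le).exists_int_eq_add v (i := 1) (j := 0) (k := 2)
    (by decide) (by decide) (by decide)
  obtain ⟨t', ht'⟩ := (h.isEnnolaRoots hs.three_le).exists_int_eq_add w (i := 0) (j := 2)
    (k := 1) (by decide) (by decide) (by decide)
  have hlt : ∀ a : ZMod p, ((a.val : ℤ)) < p := fun a => by exact_mod_cast ZMod.val_lt a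
  have a0 := hlt (κ * (n 0 : ZMod p))
  have a1 := hlt (κ * (n 1 : ZMod p))
  have a2 := hlt (κ * (n 2 : ZMod p))
  have hpos : 0 < ((κ * (n 1 : ZMod p)).val : ℤ) := by
    exact_mod_cast Nat.pos_of_ne_zero ((ZMod.val_ne_zero _).2 (mul_ne_zero hκ h10))
  have hm0 := hv.1
  have hinj : Function.Injective ![m 1 - p, - -m 0, - -m 2] := by
    rw [neg_neg, neg_neg, m1, m2, m3]
    have := (val_sub_injective p).comp (f := ![κ * (n 1 : ZMod p), κ * n 0, κ * n 2]) (by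
      intro x y
      fin_cases x <;> fin_cases y <;>
        simp [h01, h02, h12, h01.symm, h02.symm, h12.symm, hκ])
    convert this using 1
    funext x
    fin_cases x <;> rfl
  have s0 := hsz 0
  have s1 := hsz 1
  have s2 := hsz 2
  have s0' := hsz' 0
  have s1' := hsz' 1
  have s2' := hsz' 2
  rw [m1', ← m1] at s0'
  rw [m2', ← m2, ← neg_neg (m 0)] at s2'
  rw [m3', ← m3, ← neg_neg (m 2)] at s1'
  rw [← neg_neg (m 0)] at s0
  rw [← neg_neg (m 2)] at s2
  refine false_of_exponents_cyclic hs (X := m 1) (Y := -m 0) (Z := -m 2) (by omega) (by omega)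
    (by omega) (by omega) hinj ?_ s1 s0 s2 s0' s2' s1' ht ht'
  -- The difference of the two coefficients is `-m 0 + m 1 + m 2 = -2 * m 0`, and `m 0` is negative.
  simp only [coeffExponents, coeffRoot, coeffSubOne, Matrix.cons_val_zero, Matrix.cons_val_one]
  omega

end Generic

/-! ### Case distinction and conclusion -/

theorem IsScale.not_dvd_unitIndex {l p : ℕ} {τ : ℝ} (hs : IsScale l p τ) (hp : p.Prime) :
    ¬ p ∣ unitIndex l := by
  intro hdvd
  have : Fact p.Prime := ⟨hp⟩
  obtain ⟨θ, h⟩ := exists_isLocatedRoots hs.three_le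
  obtain ⟨u, n, hu, i₀, hi₀⟩ := h.exists_hasExponents hs.three_le hp hdvd
  rw [← CharP.intCast_eq_zero_iff (ZMod p) p] at hi₀
  rcases hp.eq_two_or_odd' with rfl | hodd
  · exact hu.false_of_two h hs ⟨i₀, hi₀⟩
  have hp3 : 3 ≤ p := by
    have := hp.two_le
    rcases hodd with ⟨k, rfl⟩
    omega
  by_cases hz : ∃ i, (n i : ZMod p) = 0
  · obtain ⟨i, hi⟩ := hz
    have hne : i ≠ i₀ := by rintro rfl; exact hi₀ hi
    obtain ⟨k, hik, hjk⟩ := exists_third i i₀ hne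
    exact hu.false_of_zero h hs hp3 hne hik hjk hi hi₀
  push Not at hz
  rcases Nat.eq_or_lt_of_le hp3 with rfl | hp3
  · exact hu.false_of_three h hs (hz 0) (hz 1) (hz 2)
  have hp5 : 5 ≤ p := by
    rcases hodd with ⟨k, rfl⟩
    omega
  by_cases heq : ∃ i j, i ≠ j ∧ (n i : ZMod p) = n j
  · obtain ⟨i, j, hij, hnij⟩ := heq
    obtain ⟨k, hik, hjk⟩ := exists_third i j hij
    exact hu.false_of_eq h hs hp5 hij hik hjk hnij (hz i)
  push Not at heq
  have hsum : ∑ i, (n i : ZMod p) = 0 := by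
    rw [Fin.sum_univ_three]
    exact_mod_cast congrArg (Int.cast : ℤ → ZMod p) hu.1
  by_cases hq : (n 0 : ZMod p) ^ 2 + n 0 * n 1 + (n 1 : ZMod p) ^ 2 = 0
  · have key : ∀ κ : ZMod p, κ ≠ 0 → residueSum (fun i => (n i : ZMod p)) κ = 2 * p → False :=
      fun κ hκ h1 => hu.false_of_cyclic h hs (hz 0) (hz 1) (heq 0 1 (by decide))
        (heq 0 2 (by decide)) (heq 1 2 (by decide)) hq hκ h1
    rcases residueSum_eq (r := fun i => (n i : ZMod p)) hz hsum one_ne_zero with h1 | h1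
    · have := residueSum_neg (r := fun i => (n i : ZMod p)) hz one_ne_zero
      exact key (-1) (neg_ne_zero.2 one_ne_zero) (by omega)
    · exact key 1 one_ne_zero h1
  · obtain ⟨i, κ, κ', hκ, hκ', h1, h2⟩ :=
      exists_residueSum_eq (r := fun i => (n i : ZMod p)) hz hsum
    have d1 : i ≠ i + 1 := (by decide : ∀ i : Fin 3, i ≠ i + 1) i
    have d2 : i ≠ i + 2 := (by decide : ∀ i : Fin 3, i ≠ i + 2) i
    have d3 : i + 1 ≠ i + 2 := (by decide : ∀ i : Fin 3, i + 1 ≠ i + 2) i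
    refine hu.false_of_generic h hs d1 d2 d3 (hz _) (hz _) (hz _) (heq _ _ d1) (heq _ _ d2)
      (heq _ _ d3) ?_ hκ hκ' h1 h2
    -- On vectors of sum zero the quadratic form is invariant under cyclic shifts, so its vanishing
    -- does not depend on `i`.
    rw [Fin.sum_univ_three] at hsum
    have h3 : (n 2 : ZMod p) = -n 0 - n 1 := by linear_combination hsum
    intro h0
    apply hq
    rw [← h0]
    fin_cases i
    · rfl
    · change _ = (n 1 : ZMod p) ^ 2 + n 1 * n 2 + (n 2 : ZMod p) ^ 2
      rw [h3]; ring
    · change _ = (n 2 : ZMod p) ^ 2 + n 2 * n 0 + (n 0 : ZMod p) ^ 2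
      rw [h3]; ring

theorem not_dvd_unitIndex {l p : ℕ} (hp : p.Prime) (hl : (1000 * p) ^ p ≤ l) :
    ¬ p ∣ unitIndex l := by
  have hl' : (1000 * (p : ℝ)) ^ p ≤ l := by exact_mod_cast hl
  have hpow : ((l : ℝ) ^ ((p : ℝ)⁻¹)) ^ p = l :=
    Real.rpow_inv_natCast_pow (Nat.cast_nonneg l) hp.ne_zero
  refine IsScale.not_dvd_unitIndex (τ := (l : ℝ) ^ ((p : ℝ)⁻¹)) ⟨hp.two_le, hpow, ?_⟩ hp
  rw [← hpow] at hl'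
  exact (pow_le_pow_iff_left₀ (by positivity) (by positivity) hp.ne_zero).1 hl'

theorem theorem1 :
    (∀ p : ℕ, p.Prime → 3 ≤ p → {l : ℕ | 3 ≤ l ∧ p ∣ unitIndex l}.Finite) ∧
    ∃ L : ℕ → ℕ, Computable L ∧
      ∀ N : ℕ, 2 ≤ N → ∀ l : ℕ, 3 ≤ l → L N ≤ l →
        Nat.gcd (unitIndex l) (Nat.factorial N) = 1 := by
  constructor
  · intro p hp _
    refine (Set.finite_lt_nat ((1000 * p) ^ p)).subset fun l hl => ?_
    by_contra hlt
    exact not_dvd_unitIndex hp (not_lt.1 hlt) hl.2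
  · refine ⟨fun N => (1000 * N) ^ N, ?_, ?_⟩
    · have hpow : Primrec₂ fun a b : ℕ => a ^ b := Primrec₂.unpaired'.1 Nat.Primrec.pow
      exact (hpow.comp (Primrec.nat_mul.comp (Primrec.const 1000) Primrec.id)
        Primrec.id).to_comp
    · intro N _ l _ hL
      by_contra hgcd
      obtain ⟨p, hp, hdvd⟩ := Nat.exists_prime_and_dvd hgcd
      have hpN : p ≤ N := (hp.dvd_factorial).1 (hdvd.trans (Nat.gcd_dvd_right _ _))
      refine not_dvd_unitIndex hp ?_ (hdvd.trans (Nat.gcd_dvd_left _ _))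
      refine le_trans ?_ hL
      calc (1000 * p) ^ p ≤ (1000 * N) ^ p := by gcongr
        _ ≤ (1000 * N) ^ N := Nat.pow_le_pow_right (by have := hp.pos; omega) hpN
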